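/- Let $R$ be an associative ring with $1$, not necessarily commutative, and let $n\ge 3$. Modules are right $R$-modules. **Notation.** $E_n(R)\subset GL_n(R)$ is generated by the elementary matrices $E_{ij}(r)=I_n+re_{ij}$ ($i\ne j$), $St_n(R)$ is the Steinberg group with generators $X_{ij}(r)$, and $\theta:St_n(R)\to GL_n(R)$, $X_{ij}(r)\mapsto E_{ij}(r)$, the canonical map. $Um_n(R)$ is the set of rows $v\in R^n$ with $\sum_i v_iw_i=1$ for some $w\in R^n$; $GL_n(R)$ acts on it from the right; $e=(1,0,\dots,0)$ and $EUm_n(R)=eE_n(R)$. A set $\alpha$ of pairs $(i,j)$, $1\le i\neq j\le n$, is *nilpotent* if $(i,j)\in\alpha\Rightarrow(j,i)\notin\alpha$ and $(i,j),(j,k)\in\alpha\Rightarrow(i,k)\in\alpha$. The local groups are: $E_n(R)_\alpha$, the matrices with diagonal entries $1$ and with off-diagonal entries $0$ outside $\alpha$, and $St_n(R)_\alpha=\langle X_{ij}(r): (i,j)\in\alpha\rangle$. They make $Um_n(R)$, $EUm_n(R)$ and (by right multiplication) $St_n(R)$ into single domain global actions. A path in such an action is a sequence $(x_k)_{k\in\mathbb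 Z}$, constant for $k\ll0$ and for $k\gg0$, such that $x_k,x_{k+1}$ always lie in one orbit of some local group; a loop at $x$ is a path with both end values $x$. $\pi_0$ is the set of path components. $\pi_1(EUm_n(R))$ is the set of classes of loops at $e$ under stable homotopy: $\omega\simeq\omega'$ if there are points $H(k,l)$, $(k,l)\in\mathbb Z^2$, such that the four corners of each unit square lie in one orbit of some local group, each row $H(\cdot,l)$ is a loop at $e$, and $H(\cdot,l)$ is $\omega$ for $l\ll0$ and $\omega'$ for $l\gg0$. The base points are the component of $e$ and the class of the constant loop. Let $P_n(R)=\{\sigma\in GL_n(R): e\sigma=e\}$, $EP_n(R)=P_n(R)\cap E_n(R)$, $\widetilde{P_n}(R)=\theta^{-1}(EP_n(R))$. Let $(EP_n(R))_2$ be generated by the elements of $EP_n(R)$ of the form $x^{-1}abx$ with $x\in E_n(R)$ and $a,b$ in local groups $E_n(R)_\alpha,E_n(R)_\beta$, and let $(\widetilde{P_n}(R))_2$ be generated by the elements of $\widetilde{P_n}(R)$ of the form $x^{-1}abx$ with $x\in St_n(R)$ and $a,b$ in local groups $St_n(R)_\alpha,St_n(R)_\beta$. Put - $K_{2,n}(R)=\ker\theta$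 and $(K_{2,n}(R))_2=K_{2,n}(R)\cap(\widetilde{P_n}(R))_2$, pointed by $1$; - $K_{1,n}(R)=\{\sigma E_n(R):\sigma\in GL_n(R)\}$, with base point $[I_n]$; - $(K_{1,n-1}(R))_2=\{[\tau]:\tau\in GL_{n-1}(R),\ \mathrm{diag}(1,\tau)\in(EP_n(R))_2\}$, and $K_{1,n-1}(R)/(K_{1,n-1}(R))_2$, in which $[\sigma]$ and $[\tau]$ are identified when $[\sigma^{-1}\tau]\in(K_{1,n-1}(R))_2$, pointed by the class of $I_{n-1}$; - $K^s_{0,m}(R)$, the set of isomorphism classes of finitely generated projective modules $P$ with $P\oplus R^r\cong R^{m+r}$ for some $r$, with base point $[R^m]$. **Statement.** Every $Y\in\widetilde{P_n}(R)$ is the end point of a path $(s_k)$ in $St_n(R)$ starting at $1$ for which $(e\,\theta(s_k))$ is a loop in $EUm_n(R)$; sending $Y$ to the class of any such loop induces a bijection $\Psi:\widetilde{P_n}(R)/(\widetilde{P_n}(R))_2\to\pi_1(EUm_n(R))$. There are well-defined base point preserving maps $$(K_{2,n}(R))_2\xrightarrow{\delta}K_{2,n}(R)\xrightarrow{\eta}\pi_1(EUm_n(R))\xrightarrow{\mu}K_{1,n-1}(R)/(K_{1,n-1}(R))_2\xrightarrow{\lambda}K_{1,n}(R)\xrightarrow{\alpha}\pi_0(Um_n(R))\xrightarrow{\beta}K^s_{0,n-1}(R)\xrightarrow{\gamma}K^s_{0,n}(R)$$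 given by: $\delta$ is the inclusion; $\eta(Y)=\Psi([Y])$; $\mu(\Psi([Y]))$ is the class of the lower right $(n-1)\times(n-1)$ block of $\theta(Y)$; $\lambda$ sends the class of $\tau$ to $[\mathrm{diag}(1,\tau)]$; $\alpha([\sigma])=[e\sigma]$; $\beta([v])=[\ker\beta_v]$ with $\beta_v:R^n\to R$, $w\mapsto\sum_i v_iw_i$; $\gamma([P])=[P\oplus R]$. This sequence of pointed sets is exact: at each of the six inner terms, the image of the incoming map is the preimage of the base point under the outgoing map. -/

import Mathlib

noncomputable section

namespace UmGA

universe u v w u' v' w'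

set_option linter.checkUnivs false

/-! ## Global actions, paths and stable homotopy -/

/-- A global action: a set `X`, an index set `Φ` with a reflexive relation, right actions of groups
`G a` on subsets `dom a` of `X`, and structure homomorphisms `G a →* G b` for `a ≤ b`, compatible
with the actions on `dom a ∩ dom b`. -/
structure GlobalAction where
  X : Type u
  Φ : Type v
  le : Φ → Φ → Prop
  le_refl : ∀ a, le a a
  dom : Φ → Set X
  G : Φ → Type w
  [group : ∀ a, Group (G a)]
  act : ∀ a, dom a → G a → dom a
  act_one : ∀ a x, act a x 1 = x
  act_mul : ∀ a x g h, act a x (g * h) = act a (act a x g) h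
  hom : ∀ a b, le a b → G a →* G b
  act_mem : ∀ a b, le a b → ∀ (x : dom a) (g : G a), (x : X) ∈ dom b → (act a x g : X) ∈ dom b
  act_compat : ∀ a b (h : le a b) (x : X) (ha : x ∈ dom a) (hb : x ∈ dom b) (g : G a),
    (act a ⟨x, ha⟩ g : X) = act b ⟨x, hb⟩ (hom a b h g)

attribute [instance] GlobalAction.group

namespace GlobalAction

/-- `s` is a local frame at `x` in `a`: a finite subset of the local set `dom a`, containing `x`,
every point of which is of the form `x · g` with `g` in the local group `G a`. -/
def IsFrame (A : GlobalAction.{u, v, w}) (a : A.Φ) (x : A.X) (s : Set A.X) : Prop :=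
  s.Finite ∧ x ∈ s ∧ ∃ hx : x ∈ A.dom a, ∀ y ∈ s, ∃ g : A.G a, (A.act a ⟨x, hx⟩ g : A.X) = y

/-- A morphism of global actions is a map of the underlying sets preserving local frames. -/
def IsMorphism (A : GlobalAction.{u, v, w}) (B : GlobalAction.{u', v', w'}) (f : A.X → B.X) :
    Prop :=
  ∀ a x s, A.IsFrame a x s → ∃ b, B.IsFrame b (f x) (f '' s)

/-- The product of two global actions. -/
def prod (A : GlobalAction.{u, v, w}) (B : GlobalAction.{u', v', w'}) : GlobalAction where
  X := A.X × B.X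
  Φ := A.Φ × B.Φ
  le p q := A.le p.1 q.1 ∧ B.le p.2 q.2
  le_refl p := ⟨A.le_refl _, B.le_refl _⟩
  dom p := A.dom p.1 ×ˢ B.dom p.2
  G p := A.G p.1 × B.G p.2
  act p x g := ⟨((A.act p.1 ⟨x.1.1, x.2.1⟩ g.1 : A.X), (B.act p.2 ⟨x.1.2, x.2.2⟩ g.2 : B.X)),
    (A.act p.1 ⟨x.1.1, x.2.1⟩ g.1).2, (B.act p.2 ⟨x.1.2, x.2.2⟩ g.2).2⟩
  act_one p x := by simp [act_one]
  act_mul p x g h := by simp [act_mul]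
  hom p q h := (A.hom p.1 q.1 h.1).prodMap (B.hom p.2 q.2 h.2)
  act_mem p q h x g hx :=
    ⟨A.act_mem _ _ h.1 ⟨x.1.1, x.2.1⟩ g.1 hx.1, B.act_mem _ _ h.2 ⟨x.1.2, x.2.2⟩ g.2 hx.2⟩
  act_compat p q h x ha hb g := Prod.ext (A.act_compat _ _ h.1 x.1 ha.1 hb.1 g.1)
    (B.act_compat _ _ h.2 x.2 ha.2 hb.2 g.2)

/-- The local groups of the line action: trivial at `*` (i.e. `none`), and `ℤ/2` at `n ∈ ℤ`. -/
def LineGroup : Option ℤ → Type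
  | none => PUnit
  | some _ => Multiplicative (ZMod 2)

instance : ∀ a, Group (LineGroup a)
  | none => inferInstanceAs (Group PUnit)
  | some _ => inferInstanceAs (Group (Multiplicative (ZMod 2)))

/-- The local sets of the line action: `ℤ` at `*`, and `{n, n + 1}` at `n ∈ ℤ`. -/
def lineDom : Option ℤ → Set ℤ
  | none => Set.univ
  | some n => {n, n + 1}

/-- The action of `ℤ/2` exchanging `n` and `n + 1`. -/
def lineSwap (n : ℤ) (x : ℤ) (g : Multiplicative (ZMod 2)) : ℤ :=
  if g = 1 then x else 2 * n + 1 - x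

theorem lineSwap_mem {n x : ℤ} (h : x ∈ lineDom (some n)) (g : Multiplicative (ZMod 2)) :
    lineSwap n x g ∈ lineDom (some n) := by
  simp only [lineDom, lineSwap, Set.mem_insert_iff, Set.mem_singleton_iff] at h ⊢
  split_ifs <;> omega

theorem lineSwap_mul (n x : ℤ) (g h : Multiplicative (ZMod 2)) :
    lineSwap n x (g * h) = lineSwap n (lineSwap n x g) h := by
  have key : ∀ g h : Multiplicative (ZMod 2), g * h = 1 ↔ (g = 1 ↔ h = 1) := by decide
  have := key g h
  unfold lineSwap
  split_ifs <;> first | omega | tauto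

/-- The actions of the local groups of the line action. -/
def lineAct : ∀ a : Option ℤ, lineDom a → LineGroup a → lineDom a
  | none, x, _ => x
  | some n, x, g => ⟨lineSwap n x g, lineSwap_mem x.2 g⟩

/-- The structure homomorphisms of the line action. -/
def lineHom : ∀ a b : Option ℤ, a = none ∨ a = b → LineGroup a →* LineGroup b
  | none, _, _ => 1
  | some _, some _, _ => MonoidHom.id (Multiplicative (ZMod 2))
  | some _, none, _ => 1

/-- The line action `L`: underlying set `ℤ`, index set `ℤ ∪ {*}` with the relations `* ≤ n` and
`a ≤ a`. -/
def line : GlobalAction where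
  X := ℤ
  Φ := Option ℤ
  le a b := a = none ∨ a = b
  le_refl _ := Or.inr rfl
  dom := lineDom
  G := LineGroup
  act := lineAct
  act_one a x := by
    cases a with
    | none => rfl
    | some n => exact Subtype.ext (if_pos rfl : lineSwap n x 1 = x)
  act_mul a x g h := by
    cases a with
    | none => rfl
    | some n => exact Subtype.ext (lineSwap_mul n x g h)
  hom := lineHom
  act_mem a b h x g hx := by
    rcases h with rfl | rfl
    · exact hx
    · exact Subtype.prop _
  act_compat a b h x ha hb g := by
    rcases h with rfl | rfl
    · cases b with
      | none => rfl
      | some n => exact (if_pos rfl : lineSwap n x 1 = x).symm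
    · cases a <;> rfl

variable (A : GlobalAction.{u, v, w})

/-- `ω` is a path in `A` with initial point `x` and terminal point `y`: a morphism from the line
action to `A` stabilizing on the left to `x` and on the right to `y`. -/
def IsPath (ω : ℤ → A.X) (x y : A.X) : Prop :=
  line.IsMorphism A ω ∧ (∃ N : ℤ, ∀ k ≤ N, ω k = x) ∧ (∃ N : ℤ, ∀ k ≥ N, ω k = y)

/-- Two points are path connected if some path leads from one to the other. -/
def PathConnected (x y : A.X) : Prop := ∃ ω, A.IsPath ω x y

/-- The path components of `A` (path connectedness is an equivalence relation). -/
def Pi0 : Type u := Quot A.PathConnected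

/-- The loops of `A` at `x`. -/
def Loop (x : A.X) : Type u := {ω : ℤ → A.X // A.IsPath ω x x}

/-- Stable homotopy of loops at `x`: a morphism `H : L × L → A` all of whose rows `H (·, n)` are
loops at `x`, equal to `ω` for all `n` small enough and to `ω'` for all `n` large enough. -/
def StablyHomotopic (x : A.X) (ω ω' : A.Loop x) : Prop :=
  ∃ H : ℤ × ℤ → A.X, (line.prod line).IsMorphism A H ∧
    (∀ n : ℤ, A.IsPath (fun k => H (k, n)) x x) ∧
    (∃ N : ℤ, ∀ n ≤ N, ∀ k, H (k, n) = ω.1 k) ∧ (∃ N : ℤ, ∀ n ≥ N, ∀ k, H (k, n) = ω'.1 k)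

/-- The underlying set of the fundamental group of `A` at `x`: stable homotopy classes of loops
(stable homotopy is an equivalence relation). -/
def Pi1 (x : A.X) : Type u := Quot (A.StablyHomotopic x)

theorem isPath_const [Nonempty A.Φ] (hA : ∀ a, A.dom a = Set.univ) (x : A.X) :
    A.IsPath (fun _ => x) x x := by
  refine ⟨fun a k s h => ?_, ⟨0, fun _ _ => rfl⟩, ⟨0, fun _ _ => rfl⟩⟩
  obtain ⟨b⟩ := ‹Nonempty A.Φ›
  refine ⟨b, h.1.image _, ⟨k, h.2.1, rfl⟩, by simp [hA], ?_⟩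
  rintro y ⟨j, -, rfl⟩
  exact ⟨1, by rw [A.act_one]⟩

/-- The single domain global action given by a right action of a group `Γ` on a set `X` and an
order preserving family of subgroups of `Γ`; the structure homomorphisms are the inclusions. -/
def singleDomain {Γ : Type u'} [Group Γ] (X : Type u) (act : X → Γ → X) (h1 : ∀ x, act x 1 = x)
    (hmul : ∀ x g h, act x (g * h) = act (act x g) h) {I : Type v} [Preorder I]
    (H : I → Subgroup Γ) (mono : Monotone H) : GlobalAction.{u, v, u'} where
  X := X
  Φ := I
  le := (· ≤ ·)
  le_refl _ := le_rfl
  dom _ := Set.univ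
  G a := H a
  act _ x g := ⟨act x g, trivial⟩
  act_one _ x := by simp [h1]
  act_mul _ x g h := by simp [hmul]
  hom _ _ h := Subgroup.inclusion (mono h)
  act_mem _ _ _ _ _ _ := trivial
  act_compat _ _ _ _ _ _ _ := rfl

end GlobalAction

/-! ## Elementary groups, standard unipotent subgroups and the Steinberg group -/

open Matrix
open scoped commutatorElement

/-- The off-diagonal positions of an `n × n` matrix. -/
abbrev OffDiag (n : ℕ) : Type := {p : Fin n × Fin n // p.1 ≠ p.2}

/-- The nilpotent sets of off-diagonal positions. -/
structure NilIndex (n : ℕ) where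
  carrier : Set (Fin n × Fin n)
  off_diag : ∀ i j, (i, j) ∈ carrier → i ≠ j
  asymm : ∀ i j, (i, j) ∈ carrier → (j, i) ∉ carrier
  trans : ∀ i j k, (i, j) ∈ carrier → (j, k) ∈ carrier → (i, k) ∈ carrier

instance (n : ℕ) : Preorder (NilIndex n) where
  le a b := a.carrier ⊆ b.carrier
  le_refl _ := subset_rfl
  le_trans _ _ _ := Set.Subset.trans

instance (n : ℕ) : Nonempty (NilIndex n) := ⟨⟨∅, by simp, by simp, by simp⟩⟩

section Groups

variable (n : ℕ) (R : Type u) [Ring R]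

variable {n R} in
/-- The elementary matrix `E_{ij}(r) = 1 + r e_{ij}`, `i ≠ j`. -/
def elem (p : OffDiag n) (r : R) : GL (Fin n) R where
  val := 1 + single p.1.1 p.1.2 r
  inv := 1 + single p.1.1 p.1.2 (-r)
  val_inv := by
    have h : single p.1.1 p.1.2 r * single p.1.1 p.1.2 (-r) = 0 :=
      single_mul_single_of_ne _ _ _ _ p.2.symm _
    rw [add_mul, mul_add, mul_add, h, ← single_neg]
    simp
  inv_val := by
    have h : single p.1.1 p.1.2 (-r) * single p.1.1 p.1.2 r = 0 :=
      single_mul_single_of_ne _ _ _ _ p.2.symm _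
    rw [add_mul, mul_add, mul_add, h, ← single_neg]
    simp

/-- The elementary group `E_n(R)`, generated by all elementary matrices. -/
def E : Subgroup (GL (Fin n) R) := Subgroup.closure {g | ∃ p r, g = elem p r}

variable {n} in
/-- The local group (standard unipotent subgroup) attached to a nilpotent set `α`: all matrices
with diagonal entries `1` and with off-diagonal entries `0` outside of `α`. -/
def unip (α : NilIndex n) : Subgroup (GL (Fin n) R) where
  carrier := {g | (∀ i, g.1 i i = 1) ∧ ∀ i j, i ≠ j → (i, j) ∉ α.carrier → g.1 i j = 0}
  one_mem' := ⟨fun i => by simp, fun i j h _ => by simp [h]⟩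
  mul_mem' := by
    rintro g h ⟨hg1, hg⟩ ⟨hh1, hh⟩
    refine ⟨fun i => ?_, fun i j hij hα => ?_⟩
    · rw [Units.val_mul, mul_apply, Finset.sum_eq_single i, hg1, hh1, one_mul]
      · intro k _ hk
        by_cases h1 : (i, k) ∈ α.carrier
        · rw [hh k i hk (α.asymm _ _ h1), mul_zero]
        · rw [hg i k hk.symm h1, zero_mul]
      · simp
    · rw [Units.val_mul, mul_apply]
      refine Finset.sum_eq_zero fun k _ => ?_
      by_cases hik : i = k
      · subst hik
        rw [hh i j hij hα, mul_zero]
      by_cases hkj : k = j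
      · subst hkj
        rw [hg i k hij hα, zero_mul]
      by_cases h1 : (i, k) ∈ α.carrier
      · rw [hh k j hkj (fun h2 => hα (α.trans _ _ _ h1 h2)), mul_zero]
      · rw [hg i k hik h1, zero_mul]
  inv_mem' := by
    rintro g ⟨hg1, hg⟩
    have : IsTrans (Fin n) (fun i j => (i, j) ∈ α.carrier) := ⟨α.trans⟩
    have : Std.Irrefl (fun i j : Fin n => (i, j) ∈ α.carrier) :=
      ⟨fun i h => α.off_diag i i h rfl⟩
    have wf : WellFounded (fun i j : Fin n => (i, j) ∈ α.carrier) :=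
      Finite.wellFounded_of_trans_of_irrefl _
    have key : ∀ j : Fin n, (g⁻¹).1 j j = 1 ∧
        ∀ i, i ≠ j → (i, j) ∉ α.carrier → (g⁻¹).1 i j = 0 := by
      intro j
      induction j using wf.induction with
      | _ j ih =>
      have e : ∀ i, (g⁻¹).1 i j + ∑ k ∈ Finset.univ.erase j, (g⁻¹).1 i k * g.1 k j =
          (1 : Matrix (Fin n) (Fin n) R) i j := by
        intro i
        have := congrFun (congrFun (Units.inv_mul g) i) j
        rw [mul_apply, ← Finset.add_sum_erase _ _ (Finset.mem_univ j), hg1, mul_one] at this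
        exact this
      have z : ∀ i, (i, j) ∉ α.carrier →
          ∑ k ∈ Finset.univ.erase j, (g⁻¹).1 i k * g.1 k j = 0 := by
        intro i hi
        refine Finset.sum_eq_zero fun k hk => ?_
        have hkj : k ≠ j := Finset.ne_of_mem_erase hk
        by_cases h1 : (k, j) ∈ α.carrier
        · have hik : i ≠ k := by
            rintro rfl
            exact hi h1
          rw [(ih k h1).2 i hik (fun h2 => hi (α.trans _ _ _ h2 h1)), zero_mul]
        · rw [hg k j hkj h1, mul_zero]
      refine ⟨?_, fun i hij hi => ?_⟩
      · have := e j
        rwa [z j (fun h => α.off_diag j j h rfl), add_zero, one_apply_eq] at this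
      · have := e i
        rwa [z i hi, add_zero, one_apply_ne hij] at this
    exact ⟨fun i => (key i).1, fun i j h1 h2 => (key j).2 i h1 h2⟩

theorem unip_mono : Monotone (unip (n := n) R) :=
  fun _ _ h _ hg => ⟨hg.1, fun i j hij hj => hg.2 i j hij (fun hi => hj (h hi))⟩

variable {n R} in
/-- The standard unipotent subgroups are generated by the elementary matrices they contain. -/
theorem unip_eq_closure (α : NilIndex n) :
    unip R α = Subgroup.closure {g | ∃ p : OffDiag n, ∃ r, p.1 ∈ α.carrier ∧ g = elem p r} := by
  classical
  apply le_antisymm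
  swap
  · rw [Subgroup.closure_le]
    rintro _ ⟨p, r, hp, rfl⟩
    refine ⟨fun i => ?_, fun i j hij hα => ?_⟩
    · have : ¬ (p.1.1 = i ∧ p.1.2 = i) := fun h => p.2 (h.1.trans h.2.symm)
      simp [elem, this]
    · have : ¬ (p.1.1 = i ∧ p.1.2 = j) := by
        rintro ⟨rfl, rfl⟩
        exact hα hp
      simp [elem, this, hij]
  intro g hg
  obtain ⟨N, hN⟩ : ∃ N, (Finset.univ.filter
    fun p : Fin n × Fin n => p.1 ≠ p.2 ∧ g.1 p.1 p.2 ≠ 0).card = N := ⟨_, rfl⟩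
  induction N using Nat.strong_induction_on generalizing g with
  | _ N ih =>
  have : IsTrans (Fin n) (fun i j => (i, j) ∈ α.carrier) := ⟨α.trans⟩
  have : Std.Irrefl (fun i j : Fin n => (i, j) ∈ α.carrier) :=
    ⟨fun i h => α.off_diag i i h rfl⟩
  have wf : WellFounded (fun i j : Fin n => (i, j) ∈ α.carrier) :=
    Finite.wellFounded_of_trans_of_irrefl _
  by_cases h0 : {j : Fin n | ∃ i, i ≠ j ∧ g.1 i j ≠ 0}.Nonempty
  · obtain ⟨j, ⟨i, hij, hgij⟩, hmin⟩ := wf.has_min _ h0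
    have hα : (i, j) ∈ α.carrier := by
      by_contra h
      exact hgij (hg.2 i j hij h)
    have hi : ∀ k, k ≠ i → g.1 k i = 0 := by
      intro k hk
      by_contra h
      exact hmin i ⟨k, hk, h⟩ hα
    let ε : GL (Fin n) R := elem ⟨(i, j), hij⟩ (-g.1 i j)
    have hε : ε ∈ Subgroup.closure
        {g | ∃ p : OffDiag n, ∃ r, p.1 ∈ α.carrier ∧ g = elem p r} :=
      Subgroup.subset_closure ⟨_, _, hα, rfl⟩
    have hεu : ε ∈ unip R α := by
      refine ⟨fun k => ?_, fun k l hkl hα' => ?_⟩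
      · have : ¬ (i = k ∧ j = k) := fun h => hij (h.1.trans h.2.symm)
        simp [ε, elem, this]
      · have : ¬ (i = k ∧ j = l) := by
          rintro ⟨rfl, rfl⟩
          exact hα' hα
        simp [ε, elem, this, hkl]
    have hent : ∀ k l, (g * ε).1 k l = if k = i ∧ l = j then 0 else g.1 k l := by
      intro k l
      have : (g * ε).1 k l = g.1 k l + (g.1 * single i j (-g.1 i j)) k l := by
        simp only [ε, elem, Units.val_mul, mul_add, mul_one, Matrix.add_apply]
      rw [this]
      by_cases hl : l = j
      · subst hl
        rw [mul_single_apply_same]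
        by_cases hk : k = i
        · subst hk
          simp [hg.1]
        · simp [hk, hi k hk]
      · rw [mul_single_apply_of_ne _ _ _ _ _ hl]
        simp [hl]
    have hmem := ih _ ?_ (mul_mem hg hεu) rfl
    · have := mul_mem hmem (inv_mem hε)
      rwa [mul_inv_cancel_right] at this
    · rw [← hN]
      apply Finset.card_lt_card
      refine ⟨fun p hp => ?_, fun hsub => ?_⟩
      · simp only [Finset.mem_filter, Finset.mem_univ, true_and, hent] at hp ⊢
        refine ⟨hp.1, fun h => hp.2 ?_⟩
        simp [h]
      · have := @hsub (i, j) (by simp [hij, hgij])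
        simp [hent] at this
  · have : g = 1 := by
      apply Units.ext
      ext i j
      by_cases hij : i = j
      · subst hij
        simp [hg.1]
      · rw [Units.val_one, one_apply_ne hij]
        by_contra h
        exact h0 ⟨j, i, hij, h⟩
    rw [this]
    exact one_mem _

variable {n R} in
/-- The standard unipotent subgroups lie in the elementary group. -/
theorem unip_le_E (α : NilIndex n) : unip R α ≤ E n R := by
  rw [unip_eq_closure]
  refine Subgroup.closure_mono ?_
  rintro _ ⟨p, r, -, rfl⟩
  exact ⟨p, r, rfl⟩

variable {n R} in
theorem elem_mul_elem (p : OffDiag n) (r s : R) : elem p r * elem p s = elem p (r + s) := by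
  have h : single p.1.1 p.1.2 r * single p.1.1 p.1.2 s = 0 :=
    single_mul_single_of_ne _ _ _ _ p.2.symm _
  apply Units.ext
  simp only [elem, Units.val_mul]
  rw [add_mul, mul_add, mul_add, h, single_add]
  simp [add_assoc, add_comm]

variable {n R} in
theorem elem_comm_one {p q : OffDiag n} (h1 : p.1.2 ≠ q.1.1) (h2 : p.1.1 ≠ q.1.2) (r s : R) :
    elem p r * elem q s = elem q s * elem p r := by
  have e1 : single p.1.1 p.1.2 r * single q.1.1 q.1.2 s = 0 :=
    single_mul_single_of_ne _ _ _ _ h1 _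
  have e2 : single q.1.1 q.1.2 s * single p.1.1 p.1.2 r = 0 :=
    single_mul_single_of_ne _ _ _ _ h2.symm _
  apply Units.ext
  simp only [elem, Units.val_mul]
  rw [add_mul, mul_add, mul_add, e1, add_mul, mul_add, mul_add, e2]
  simp [add_comm, add_left_comm]

variable {n R} in
theorem elem_comm {i j l : Fin n} (hij : i ≠ j) (hjl : j ≠ l) (hil : i ≠ l) (r s : R) :
    elem ⟨(i, j), hij⟩ r * elem ⟨(j, l), hjl⟩ s =
      elem ⟨(i, l), hil⟩ (r * s) * elem ⟨(j, l), hjl⟩ s * elem ⟨(i, j), hij⟩ r := by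
  have e1 : single i l (r * s) * single j l s = 0 := single_mul_single_of_ne _ _ _ _ hjl.symm _
  have e2 : single i l (r * s) * single i j r = 0 := single_mul_single_of_ne _ _ _ _ hil.symm _
  have e3 : single j l s * single i j r = 0 := single_mul_single_of_ne _ _ _ _ hil.symm _
  apply Units.ext
  simp only [elem, Units.val_mul]
  simp only [add_mul, mul_add, e1, e2, e3, single_mul_single_same, zero_mul, mul_one, one_mul]
  abel

/-- The defining relations of the Steinberg group, on the generators `X_{ij}(r)`, `i ≠ j`. -/
inductive StRel : FreeGroup (OffDiag n × R) → Prop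
  | add (p : OffDiag n) (r s : R) :
      StRel (FreeGroup.of (p, r) * FreeGroup.of (p, s) * (FreeGroup.of (p, r + s))⁻¹)
  | comm_one (p q : OffDiag n) (h1 : p.1.2 ≠ q.1.1) (h2 : p.1.1 ≠ q.1.2) (r s : R) :
      StRel ⁅FreeGroup.of (p, r), FreeGroup.of (q, s)⁆
  | comm (i j l : Fin n) (hij : i ≠ j) (hjl : j ≠ l) (hil : i ≠ l) (r s : R) :
      StRel (⁅FreeGroup.of ((⟨(i, j), hij⟩ : OffDiag n), r),
        FreeGroup.of ((⟨(j, l), hjl⟩ : OffDiag n), s)⁆ *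
          (FreeGroup.of ((⟨(i, l), hil⟩ : OffDiag n), r * s))⁻¹)

/-- The Steinberg group `St_n(R)`. -/
abbrev St : Type u := PresentedGroup {x | StRel n R x}

/-- The canonical homomorphism `θ : St_n(R) → GL_n(R)`, `X_{ij}(r) ↦ E_{ij}(r)`. -/
def θ : St n R →* GL (Fin n) R :=
  PresentedGroup.toGroup (f := fun x => elem x.1 x.2) (by
    rintro x (⟨p, r, s⟩ | ⟨p, q, h1, h2, r, s⟩ | ⟨i, j, l, hij, hjl, hil, r, s⟩)
    · simp [elem_mul_elem]
    · simp [commutatorElement_eq_one_iff_mul_comm, elem_comm_one h1 h2]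
    · simp [commutatorElement_def, elem_comm hij hjl hil])

variable {n} in
/-- The local subgroup of the Steinberg group attached to a nilpotent set `α`. -/
def stUnip (α : NilIndex n) : Subgroup (St n R) :=
  Subgroup.closure {g | ∃ p : OffDiag n, ∃ r : R, p.1 ∈ α.carrier ∧ g = PresentedGroup.of (p, r)}

theorem stUnip_mono : Monotone (stUnip (n := n) R) := by
  intro α β h
  refine Subgroup.closure_mono ?_
  rintro g ⟨p, r, hp, rfl⟩
  exact ⟨p, r, h hp, rfl⟩

/-- The Steinberg global action: `St_n(R)` acted on by its local subgroups by right
multiplication. -/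
def stAction : GlobalAction :=
  .singleDomain (St n R) (fun x g => x * g) mul_one (fun x g h => (mul_assoc x g h).symm)
    (stUnip R) (stUnip_mono n R)

/-- `K_{2,n}(R)`, the kernel of `θ`. -/
def K2 : Subgroup (St n R) := (θ n R).ker

/-- `K_{1,n}(R) = GL_n(R) / E_n(R)`, the set of the cosets `σ E_n(R)`. -/
def K1 : Type u := GL (Fin n) R ⧸ E n R

variable {n R} in
/-- The class `σ E_n(R)` in `K_{1,n}(R)`. -/
def K1.mk (σ : GL (Fin n) R) : K1 n R := QuotientGroup.mk σ

end Groups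

/-! ## Unimodular rows of length `n = m + 1` -/

section Rows

variable (m : ℕ) (R : Type u) [Ring R]

/-- The unimodular rows of length `n`. -/
def Um (n : ℕ) : Type u := {v : Fin n → R // ∃ w : Fin n → R, v ⬝ᵥ w = 1}

variable {R} in
/-- The right action of `GL_n(R)` on unimodular rows, `(v, σ) ↦ v σ`. -/
def Um.act {n : ℕ} (v : Um R n) (σ : GL (Fin n) R) : Um R n :=
  ⟨v.1 ᵥ* σ.1, by
    obtain ⟨w, hw⟩ := v.2
    refine ⟨(σ⁻¹).1 *ᵥ w, ?_⟩
    rw [dotProduct_mulVec, vecMul_vecMul, Units.mul_inv, vecMul_one, hw]⟩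

variable {R} in
theorem Um.act_one {n : ℕ} (v : Um R n) : v.act 1 = v := Subtype.ext (vecMul_one _)

variable {R} in
theorem Um.act_mul {n : ℕ} (v : Um R n) (σ τ : GL (Fin n) R) :
    v.act (σ * τ) = (v.act σ).act τ := Subtype.ext (vecMul_vecMul v.1 σ.1 τ.1).symm

/-- The unimodular row global action. -/
def umAction (n : ℕ) : GlobalAction :=
  .singleDomain (Um R n) Um.act Um.act_one Um.act_mul (unip R) (unip_mono n R)

/-- The row `e = (1, 0, …, 0)`. -/
def e : Um R (m + 1) := ⟨Pi.single 0 1, Pi.single 0 1, by simp⟩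

/-- The elementary unimodular rows, the orbit `e E_n(R)`. -/
def EUm : Type u := {v : Um R (m + 1) // ∃ ε ∈ E (m + 1) R, (e m R).act ε = v}

/-- The elementary unimodular row global action: the orbit `e E_n(R)` with the action of the
local groups of `E_n(R)`, which are those of `GL_n(R)` as these lie in `E_n(R)`. -/
def eumAction : GlobalAction :=
  .singleDomain (EUm m R)
    (fun v (ε : E (m + 1) R) => ⟨v.1.act ε, by
      obtain ⟨ε', h, h'⟩ := v.2
      exact ⟨ε' * ε, mul_mem h ε.2, by rw [Um.act_mul, h']⟩⟩)
    (fun v => Subtype.ext v.1.act_one) (fun v g h => Subtype.ext (v.1.act_mul g h))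
    (fun α => (unip R α).subgroupOf (E (m + 1) R))
    (fun _ _ h => Subgroup.comap_mono (unip_mono _ R h))

/-- The base point `e` of the elementary unimodular rows. -/
def eBase : (eumAction m R).X := (⟨e m R, 1, one_mem _, Um.act_one _⟩ : EUm m R)

/-- The underlying set of `π₁(EUm_n(R))`, at the base point `e`. -/
abbrev Pi1EUm : Type u := (eumAction m R).Pi1 (eBase m R)

/-- The class of the constant loop. -/
def pi1Base : Pi1EUm m R :=
  Quot.mk _ ⟨fun _ => eBase m R, by
    have : Nonempty (eumAction m R).Φ := inferInstanceAs (Nonempty (NilIndex (m + 1)))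
    exact (eumAction m R).isPath_const (fun _ => rfl) _⟩

/-- The loop `ω` in `EUm_n(R)` lifts to a path from `1` to `Y` in the Steinberg global action, i.e.
there is such a path `s` with `ω(k) = e θ(s(k))` for all `k`. -/
def LiftsTo (ω : (eumAction m R).Loop (eBase m R)) (Y : St (m + 1) R) : Prop :=
  ∃ s : ℤ → St (m + 1) R, (stAction (m + 1) R).IsPath s (1 : St (m + 1) R) Y ∧
    ∀ k : ℤ, (ω.1 k : EUm m R).1 = (e m R).act (θ (m + 1) R (s k))

/-- `π₀(Um_n(R))`. -/
abbrev Pi0Um : Type u := (umAction R (m + 1)).Pi0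

variable {m R} in
/-- The path component of a unimodular row. -/
def Pi0Um.mk (v : Um R (m + 1)) : Pi0Um m R := Quot.mk _ v

/-- `P_n(R)`, the stabilizer of `e` in `GL_n(R)`. -/
def P : Subgroup (GL (Fin (m + 1)) R) where
  carrier := {σ | (e m R).act σ = e m R}
  one_mem' := Um.act_one _
  mul_mem' := fun {σ τ} (hσ : (e m R).act σ = e m R) (hτ : (e m R).act τ = e m R) => by
    change (e m R).act (σ * τ) = e m R
    rw [Um.act_mul, hσ, hτ]
  inv_mem' := fun {σ} (hσ : (e m R).act σ = e m R) => by
    change (e m R).act σ⁻¹ = e m R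
    conv_lhs => rw [← hσ]
    rw [← Um.act_mul, mul_inv_cancel, Um.act_one]

/-- `EP_n(R) = P_n(R) ∩ E_n(R)`. -/
def EP : Subgroup (GL (Fin (m + 1)) R) := P m R ⊓ E (m + 1) R

/-- The preimage `P̃_n(R)` of `EP_n(R)` in the Steinberg group. -/
def Pt : Subgroup (St (m + 1) R) := (EP m R).comap (θ (m + 1) R)

/-- `(EP_n(R))₂`: generated by the elements of `EP_n(R)` of the form `x⁻¹ a b x` with
`x ∈ E_n(R)` and `a`, `b` elements of local groups. -/
def EP2 : Subgroup (GL (Fin (m + 1)) R) :=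
  Subgroup.closure {g | g ∈ EP m R ∧ ∃ x ∈ E (m + 1) R, ∃ α β : NilIndex (m + 1),
    ∃ a ∈ unip R α, ∃ b ∈ unip R β, g = x⁻¹ * a * b * x}

/-- `(P̃_n(R))₂`: generated by the elements of `P̃_n(R)` of the form `x⁻¹ a b x` with
`x ∈ St_n(R)` and `a`, `b` elements of local groups. -/
def Pt2 : Subgroup (St (m + 1) R) :=
  Subgroup.closure {g | g ∈ Pt m R ∧ ∃ x : St (m + 1) R, ∃ α β : NilIndex (m + 1),
    ∃ a ∈ stUnip R α, ∃ b ∈ stUnip R β, g = x⁻¹ * a * b * x}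

/-- `(K_{2,n}(R))₂ = K_{2,n}(R) ∩ (P̃_n(R))₂`. -/
def K22 : Subgroup (St (m + 1) R) := K2 (m + 1) R ⊓ Pt2 m R

theorem K2_le_Pt : K2 (m + 1) R ≤ Pt m R := by
  intro x hx
  have : θ (m + 1) R x = 1 := hx
  change θ (m + 1) R x ∈ EP m R
  rw [this]
  exact one_mem _

/-- The embedding `GL_{n-1}(R) → GL_n(R)`, `τ ↦ diag(1, τ)`. -/
def stab : GL (Fin m) R →* GL (Fin (m + 1)) R :=
  Units.map
    { toFun := fun τ => of (Fin.cons (Fin.cons 1 0) fun i => Fin.cons 0 (τ i))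
      map_one' := by
        ext i j
        refine Fin.cases ?_ (fun i => ?_) i <;> refine Fin.cases ?_ (fun j => ?_) j <;>
          simp [one_apply, Fin.succ_ne_zero, (Fin.succ_ne_zero _).symm]
      map_mul' := fun σ τ => by
        ext i j
        refine Fin.cases ?_ (fun i => ?_) i <;> refine Fin.cases ?_ (fun j => ?_) j <;>
          simp [mul_apply, Fin.sum_univ_succ] }

variable {m R} in
theorem rd_aux (σ τ : GL (Fin (m + 1)) R) (hτ : τ ∈ P m R) (h : σ * τ = 1) :
    (σ.1).submatrix Fin.succ Fin.succ * (τ.1).submatrix Fin.succ Fin.succ =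
      (1 : Matrix (Fin m) (Fin m) R) := by
  have h0 : ∀ j : Fin m, τ.1 0 j.succ = 0 := by
    intro j
    have := congrFun (congrArg Subtype.val (hτ : (e m R).act τ = e m R)) j.succ
    simpa [Um.act, e] using this
  ext i j
  have h' : σ.1 * τ.1 = 1 := by rw [← Units.val_mul, h, Units.val_one]
  have := congrFun (congrFun h' i.succ) j.succ
  rw [mul_apply, Fin.sum_univ_succ, h0, mul_zero, zero_add] at this
  rw [mul_apply]
  simpa [one_apply] using this

variable {m R} in
/-- The lower right `(n-1) × (n-1)` block `σ_rd` of a matrix `σ ∈ P_n(R)`; it is invertible. -/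
def rd (σ : P m R) : GL (Fin m) R where
  val := (σ.1.1).submatrix Fin.succ Fin.succ
  inv := ((σ⁻¹).1.1).submatrix Fin.succ Fin.succ
  val_inv := rd_aux σ.1 (σ⁻¹).1 (σ⁻¹).2 (by simp)
  inv_val := rd_aux (σ⁻¹).1 σ.1 σ.2 (by simp)

/-- `(K_{1,n-1}(R))₂ = (GL_{n-1}(R) ∩ (EP_n(R))₂) / E_{n-1}(R)`, as a subset of `K_{1,n-1}(R)`. -/
def K12 : Set (K1 m R) := K1.mk '' {τ | stab m R τ ∈ EP2 m R}

/-- The quotient `K_{1,n-1}(R) / (K_{1,n-1}(R))₂`: the classes of `σ` and `τ` are identified if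
`σ⁻¹ τ` represents an element of `(K_{1,n-1}(R))₂`. -/
def K1Quot : Type u :=
  Quot fun x y : K1 m R => ∃ σ τ, x = K1.mk σ ∧ y = K1.mk τ ∧ K1.mk (σ⁻¹ * τ) ∈ K12 m R

variable {m R} in
/-- The class of an element of `K_{1,n-1}(R)` modulo `(K_{1,n-1}(R))₂`. -/
def K1Quot.mk (x : K1 m R) : K1Quot m R := Quot.mk _ x

/-! ## Stably free modules

Since `GL_n(R)` acts on rows from the right, columns, and hence modules, are right modules, i.e.
modules over the opposite ring `Rᵐᵒᵖ`. -/

/-- Finitely generated projective right `R`-modules `M` with `M ⊕ R^r ≅ R^{k+r}` for some `r`. -/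
def IsStablyFree (k : ℕ) (M : Type u) [AddCommGroup M] [Module Rᵐᵒᵖ M] : Prop :=
  Module.Finite Rᵐᵒᵖ M ∧ Module.Projective Rᵐᵒᵖ M ∧
    ∃ r : ℕ, Nonempty ((M × (Fin r → R)) ≃ₗ[Rᵐᵒᵖ] (Fin (k + r) → R))

/-- The isomorphism relation on the modules above. -/
def isoSetoid (k : ℕ) : Setoid {M : ModuleCat.{u} Rᵐᵒᵖ // IsStablyFree R k M} where
  r M N := Nonempty (M.1 ≃ₗ[Rᵐᵒᵖ] N.1)
  iseqv := ⟨fun _ => ⟨.refl _ _⟩, fun ⟨f⟩ => ⟨f.symm⟩, fun ⟨f⟩ ⟨g⟩ => ⟨f.trans g⟩⟩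

/-- `K^s_{0,k}(R)`. -/
def K0s (k : ℕ) : Type (u + 1) := Quotient (isoSetoid R k)

variable {R} in
/-- The isomorphism class of a module in `K^s_{0,k}(R)`. -/
def K0s.mk (k : ℕ) (M : Type u) [AddCommGroup M] [Module Rᵐᵒᵖ M] (h : IsStablyFree R k M) :
    K0s R k :=
  Quotient.mk (isoSetoid R k) ⟨ModuleCat.of Rᵐᵒᵖ M, h⟩

/-- `Rᵐᵒᵖ ≅ R` as right `R`-modules. -/
def opEquiv : Rᵐᵒᵖ ≃ₗ[Rᵐᵒᵖ] R where
  toFun x := x.unop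
  invFun x := .op x
  map_add' _ _ := rfl
  map_smul' _ _ := rfl
  left_inv _ := rfl
  right_inv _ := rfl

theorem freeOp : Module.Free Rᵐᵒᵖ R := .of_equiv (opEquiv R)

theorem finiteOp : Module.Finite Rᵐᵒᵖ R := .equiv (opEquiv R)

theorem isStablyFree_free (k : ℕ) : IsStablyFree R k (Fin k → R) := by
  have : Module.Free Rᵐᵒᵖ R := freeOp R
  have : Module.Finite Rᵐᵒᵖ R := finiteOp R
  let f : ((Fin k → R) × (Fin 0 → R)) ≃ₗ[Rᵐᵒᵖ] (Fin k → R) := .prodUnique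
  exact ⟨inferInstance, inferInstance, 0, ⟨f⟩⟩

/-- The base point of `K^s_{0,k}(R)`, the class of `R^k`. -/
def k0Base (k : ℕ) : K0s R k := K0s.mk k (Fin k → R) (isStablyFree_free R k)

variable {R} in
theorem IsStablyFree.prod_ring {k : ℕ} {M : Type u} [AddCommGroup M] [Module Rᵐᵒᵖ M]
    (h : IsStablyFree R k M) : IsStablyFree R (k + 1) (M × R) := by
  have : Module.Free Rᵐᵒᵖ R := freeOp R
  have : Module.Finite Rᵐᵒᵖ R := finiteOp R
  obtain ⟨h1, h2, r, ⟨f⟩⟩ := h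
  let f1 : ((M × R) × (Fin r → R)) ≃ₗ[Rᵐᵒᵖ] (M × (R × (Fin r → R))) := .prodAssoc _ _ _ _
  let f2 : (M × (R × (Fin r → R))) ≃ₗ[Rᵐᵒᵖ] (M × ((Fin r → R) × R)) :=
    (LinearEquiv.refl Rᵐᵒᵖ M).prodCongr (.prodComm Rᵐᵒᵖ R (Fin r → R))
  let f3 : (M × ((Fin r → R) × R)) ≃ₗ[Rᵐᵒᵖ] ((M × (Fin r → R)) × R) :=
    (LinearEquiv.prodAssoc _ _ _ _).symm
  let f4 : ((M × (Fin r → R)) × R) ≃ₗ[Rᵐᵒᵖ] ((Fin (k + r) → R) × R) :=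
    f.prodCongr (.refl Rᵐᵒᵖ R)
  let f5 : ((Fin (k + r) → R) × R) ≃ₗ[Rᵐᵒᵖ] (R × (Fin (k + r) → R)) := .prodComm _ _ _
  let f6 : (R × (Fin (k + r) → R)) ≃ₗ[Rᵐᵒᵖ] (Fin (k + r + 1) → R) :=
    Fin.consLinearEquiv Rᵐᵒᵖ (fun _ => R)
  let f7 : (Fin (k + r + 1) → R) ≃ₗ[Rᵐᵒᵖ] (Fin (k + 1 + r) → R) :=
    LinearEquiv.funCongrLeft Rᵐᵒᵖ R (finCongr (by omega))
  exact ⟨inferInstance, inferInstance, r,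
    ⟨((((((f1.trans f2).trans f3).trans f4).trans f5).trans f6).trans f7)⟩⟩

variable {R} in
/-- The right linear map `β_v : R^n → R`, `w ↦ v wᵗ = ∑ v_i w_i`, of a unimodular row `v`. -/
def rowMap {n : ℕ} (v : Um R n) : (Fin n → R) →ₗ[Rᵐᵒᵖ] R where
  toFun w := v.1 ⬝ᵥ w
  map_add' := dotProduct_add _
  map_smul' r w := by simp [dotProduct, Finset.sum_mul, mul_assoc]

variable {R m} in
theorem isStablyFree_ker (v : Um R (m + 1)) :
    IsStablyFree R m (LinearMap.ker (rowMap v)) := by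
  have : Module.Free Rᵐᵒᵖ R := freeOp R
  have : Module.Finite Rᵐᵒᵖ R := finiteOp R
  obtain ⟨w, hw⟩ := v.2
  have hv : ∀ (u : Fin (m + 1) → R) (r : R), rowMap v (fun i => w i * r) = r := by
    intro _ r
    change ∑ i, v.1 i * (w i * r) = r
    simp only [← mul_assoc, ← Finset.sum_mul]
    have : ∑ i, v.1 i * w i = 1 := hw
    rw [this, one_mul]
  have hK : ∀ x : Fin (m + 1) → R,
      x - (fun i => w i * rowMap v x) ∈ LinearMap.ker (rowMap v) := fun x => by
    rw [LinearMap.mem_ker, map_sub, hv x, sub_self]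
  let π : (Fin (m + 1) → R) →ₗ[Rᵐᵒᵖ] LinearMap.ker (rowMap v) :=
    { toFun := fun x => ⟨x - fun i => w i * rowMap v x, hK x⟩
      map_add' := fun x y => by
        ext i
        simp [mul_add]
        abel
      map_smul' := fun r x => by
        ext i
        simp [sub_mul, mul_assoc] }
  have hπ : π ∘ₗ (LinearMap.ker (rowMap v)).subtype = LinearMap.id := by
    ext x i
    simp [π]
  refine ⟨.of_surjective π fun x => ⟨x, LinearMap.congr_fun hπ x⟩, .of_split _ π hπ, 1, ⟨?_⟩⟩
  exact
    { toFun := fun p => p.1.1 + fun i => w i * p.2 0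
      invFun := fun x => (π x, fun _ => rowMap v x)
      map_add' := fun p q => by
        ext i
        simp [mul_add]
        abel
      map_smul' := fun r p => by
        ext i
        simp [mul_assoc]
      left_inv := fun p => by
        have h1 : rowMap v (p.1.1 + fun i => w i * p.2 0) = p.2 0 := by
          rw [map_add, hv 0, LinearMap.mem_ker.1 p.1.2, zero_add]
        refine Prod.ext (Subtype.ext ?_) (funext fun i => ?_)
        · change p.1.1 + (fun i => w i * p.2 0) - (fun i => w i * rowMap v _) = p.1.1
          rw [h1, add_sub_cancel_right]
        · rw [Subsingleton.elim i 0]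
          exact h1
      right_inv := fun x => sub_add_cancel x _ }

end Rows

/-- Exactness, at the middle term, of maps of pointed sets: the image of `f` is the preimage under
`g` of the base point. -/
def ExactAt {X : Type u} {Y : Type v} {Z : Type w} (f : X → Y) (g : Y → Z) (z : Z) : Prop :=
  ∀ y, g y = z ↔ y ∈ Set.range f

end UmGA

end

open UmGA

/-!
Everything about the fundamental group rests on the fact that the Steinberg group is the universal
cover of its local subgroups. The universal cover of `EUm_n(R)` is built here as the set `Cover` of
based paths modulo the deletion of points which lie in one local orbit with their two neighbours;
deleting a point does not change the stable homotopy class of a loop (`Loop.mk_eq_of_deletion`).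
Local elements of the Steinberg group act on the cover by prolonging paths. The elements occurring
in one defining relation of `St_n(R)` lie in a common local subgroup, so that the relation holds for
the prolongations, and `St_n(R)` acts on the cover (`coverHom`). Two consequences follow.

* If a loop lifts to a path from `1` to `Y` in `St_n(R)`, then its class is the image of the base
  point of the cover under `Y` (`loopClass_eq_of_liftsTo`).
* A generator `x⁻¹ a b x` of `(P̃_n(R))₂` acts trivially on the fibre over `e`, because `a` and `b`
  lead the path forth and back along one step (`coverAct_Pt2`).

Hence `Y ↦ [loop lifting to Y]` factors through `P̃_n(R) / (P̃_n(R))₂`. In the other direction, the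
projection `(P̃_n(R))₂ \ St_n(R) → EUm_n(R)` has unique local lifts, since two local elements `a`
and `b` leading from `x` to the same row give `x b a⁻¹ x⁻¹ ∈ (P̃_n(R))₂`. So homotopies lift, and the
coset of the end point of a lift depends only on the class of the loop
(`LiftsTo.sameCoset_of_stablyHomotopic`). Together these give the bijection `pi1Equiv`.

The rest of the sequence is algebra. A matrix in `P_n(R)` is `diag(1, τ)`, with `τ` its lower right
block, up to a factor in a local group, so it lies in `(EP_n(R))₂` if and only if `diag(1, τ)` does
(`stab_rd_mem_EP2_iff`); `(EP_n(R))₂` is the image of `(P̃_n(R))₂` (`map_Pt2`); path components of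
`Um_n(R)` are the orbits of `E_n(R)` (`Pi0Um.mk_eq_iff`); two unimodular rows have isomorphic
kernels if and only if they lie in one orbit of `GL_n(R)` (`nonempty_ker_equiv_iff`); and every
complement of `R` in `R^n` is the kernel of a unimodular row (`exists_ker_equiv`).
-/

noncomputable section

namespace UmGA

universe u v w u' v' w'

open Matrix

/-! ### Local orbits, paths and homotopies of a global action -/

namespace GlobalAction

section Orbits

variable {A : GlobalAction.{u, v, w}} {B : GlobalAction.{u', v', w'}}

/-- `y` is a translate of `x` under the local group `G a`. -/
def Orb (A : GlobalAction.{u, v, w}) (a : A.Φ) (x y : A.X) : Prop :=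
  ∃ hx : x ∈ A.dom a, ∃ g : A.G a, (A.act a ⟨x, hx⟩ g : A.X) = y

theorem Orb.refl {a : A.Φ} {x : A.X} (hx : x ∈ A.dom a) : A.Orb a x x :=
  ⟨hx, 1, by rw [A.act_one]⟩

theorem Orb.symm {a : A.Φ} {x y : A.X} (h : A.Orb a x y) : A.Orb a y x := by
  obtain ⟨hx, g, rfl⟩ := h
  refine ⟨Subtype.prop _, g⁻¹, ?_⟩
  rw [Subtype.coe_eta, ← A.act_mul, mul_inv_cancel, A.act_one]

theorem Orb.trans {a : A.Φ} {x y z : A.X} (h : A.Orb a x y) (h' : A.Orb a y z) : A.Orb a x z := by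
  obtain ⟨hx, g, rfl⟩ := h
  obtain ⟨hy, g', rfl⟩ := h'
  exact ⟨hx, g * g', by rw [A.act_mul]⟩

/-- The set `s` lies in a single orbit of some local group. -/
def Local (A : GlobalAction.{u, v, w}) (s : Set A.X) : Prop :=
  ∃ a, ∀ x ∈ s, ∀ y ∈ s, A.Orb a x y

theorem Local.mono {s t : Set A.X} (h : A.Local t) (hst : s ⊆ t) : A.Local s := by
  obtain ⟨a, ha⟩ := h
  exact ⟨a, fun x hx y hy => ha x (hst hx) y (hst hy)⟩

theorem local_of_orb {a : A.Φ} {x : A.X} {s : Set A.X} (h : ∀ y ∈ s, A.Orb a x y) : A.Local s :=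
  ⟨a, fun y hy z hz => (h y hy).symm.trans (h z hz)⟩

theorem isFrame_iff {a : A.Φ} {x : A.X} {s : Set A.X} :
    A.IsFrame a x s ↔ s.Finite ∧ x ∈ s ∧ ∀ y ∈ s, A.Orb a x y := by
  constructor
  · rintro ⟨h1, h2, hx, h3⟩
    exact ⟨h1, h2, fun y hy => ⟨hx, h3 y hy⟩⟩
  · rintro ⟨h1, h2, h3⟩
    exact ⟨h1, h2, (h3 x h2).1, fun y hy => (h3 y hy).2⟩

theorem isMorphism_iff {f : A.X → B.X} :
    A.IsMorphism B f ↔ ∀ a x s, A.IsFrame a x s → B.Local (f '' s) := by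
  constructor
  · intro h a x s hs
    obtain ⟨b, hb⟩ := h a x s hs
    exact local_of_orb (isFrame_iff.1 hb).2.2
  · intro h a x s hs
    obtain ⟨b, hb⟩ := h a x s hs
    have hx := Set.mem_image_of_mem f hs.2.1
    exact ⟨b, isFrame_iff.2 ⟨hs.1.image _, hx, hb _ hx⟩⟩

theorem prod_orb {a : A.Φ} {b : B.Φ} {x y : A.X × B.X} :
    (A.prod B).Orb (a, b) x y ↔ A.Orb a x.1 y.1 ∧ B.Orb b x.2 y.2 := by
  constructor
  · rintro ⟨⟨h1, h2⟩, ⟨g1, g2⟩, rfl⟩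
    exact ⟨⟨h1, g1, rfl⟩, ⟨h2, g2, rfl⟩⟩
  · rintro ⟨⟨h1, g1, e1⟩, ⟨h2, g2, e2⟩⟩
    exact ⟨⟨h1, h2⟩, (g1, g2), Prod.ext e1 e2⟩

theorem line_orb_some {n x y : ℤ} :
    line.Orb (some n) x y ↔ x ∈ ({n, n + 1} : Set ℤ) ∧ y ∈ ({n, n + 1} : Set ℤ) := by
  constructor
  · rintro ⟨hx, g, rfl⟩
    exact ⟨hx, lineSwap_mem hx g⟩
  · rintro ⟨hx, hy⟩
    by_cases h : x = y
    · subst h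
      exact Orb.refl hx
    · refine ⟨hx, Multiplicative.ofAdd (1 : ZMod 2), ?_⟩
      have h1 : (Multiplicative.ofAdd (1 : ZMod 2)) ≠ 1 := by decide
      change lineSwap n x (Multiplicative.ofAdd (1 : ZMod 2)) = y
      rw [lineSwap, if_neg h1]
      simp only [Set.mem_insert_iff, Set.mem_singleton_iff] at hx hy
      omega

/-- A local orbit of the line action lies in an interval `{n, n + 1}`. -/
theorem exists_interval_of_line_orb (a : Option ℤ) (x : ℤ) :
    ∃ n : ℤ, ∀ y, line.Orb a x y → y ∈ ({n, n + 1} : Set ℤ) := by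
  cases a with
  | none =>
    refine ⟨x, ?_⟩
    rintro y ⟨hx, g, rfl⟩
    exact Or.inl rfl
  | some n => exact ⟨n, fun y h => (line_orb_some.1 h).2⟩

/-- Paths are sequences of points any two successive ones of which lie in one local orbit. -/
theorem isMorphism_line_iff {f : ℤ → A.X} :
    line.IsMorphism A f ↔ ∀ k, A.Local {f k, f (k + 1)} := by
  refine isMorphism_iff.trans ?_
  constructor
  · intro h k
    have : A.Local (f '' ({k, k + 1} : Set ℤ)) := h (some k) k ({k, k + 1} : Set ℤ) (isFrame_iff.2
      ⟨Set.toFinite ({k, k + 1} : Set ℤ), Or.inl rfl,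
      fun y hy => line_orb_some.2 ⟨Or.inl rfl, hy⟩⟩)
    rwa [Set.image_pair] at this
  · intro h a x s hs
    obtain ⟨n, hn⟩ := exists_interval_of_line_orb a x
    refine (h n).mono ?_
    rw [← Set.image_pair]
    exact Set.image_mono fun y hy => hn y ((isFrame_iff.1 hs).2.2 y hy)

/-- The set of corners of a unit square of the plane. -/
def corners (k l : ℤ) : Set (ℤ × ℤ) := ({k, k + 1} : Set ℤ) ×ˢ ({l, l + 1} : Set ℤ)

/-- Homotopies are arrays of points in which the corners of each unit square lie in one local
orbit. -/
theorem isMorphism_plane_iff {H : ℤ × ℤ → A.X} :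
    (line.prod line).IsMorphism A H ↔ ∀ k l, A.Local (H '' corners k l) := by
  refine isMorphism_iff.trans ?_
  constructor
  · intro h k l
    exact h (some k, some l) (k, l) (corners k l) (isFrame_iff.2
      ⟨Set.toFinite (({k, k + 1} : Set ℤ) ×ˢ ({l, l + 1} : Set ℤ)), ⟨Or.inl rfl, Or.inl rfl⟩,
        fun y hy => prod_orb.2
          ⟨line_orb_some.2 ⟨Or.inl rfl, hy.1⟩, line_orb_some.2 ⟨Or.inl rfl, hy.2⟩⟩⟩)
  · rintro h ⟨a, b⟩ x s hs
    obtain ⟨k, hk⟩ := exists_interval_of_line_orb a x.1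
    obtain ⟨l, hl⟩ := exists_interval_of_line_orb b x.2
    refine (h k l).mono (Set.image_mono fun y hy => ?_)
    have := prod_orb.1 ((isFrame_iff.1 hs).2.2 y hy)
    exact ⟨hk _ this.1, hl _ this.2⟩

end Orbits

/-! ### Deleting a point of a loop -/

section Deletion

variable {A : GlobalAction.{u, v, w}} {x₀ : A.X}

theorem Loop.local (ω : A.Loop x₀) (k : ℤ) : A.Local {ω.1 k, ω.1 (k + 1)} :=
  isMorphism_line_iff.1 ω.2.1 k

/-- Two loops are stably homotopic if they can be stacked as adjacent rows. -/
theorem stablyHomotopic_of_local (ω ω' : A.Loop x₀)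
    (h : ∀ k, A.Local {ω.1 k, ω.1 (k + 1), ω'.1 k, ω'.1 (k + 1)}) : A.StablyHomotopic x₀ ω ω' := by
  refine ⟨fun p => if p.2 ≤ 0 then ω.1 p.1 else ω'.1 p.1, isMorphism_plane_iff.2 fun k l =>
    (h k).mono ?_, fun n => ?_, ⟨0, fun n hn k => if_pos hn⟩,
    ⟨1, fun n hn k => if_neg (by simp; omega)⟩⟩
  · rintro _ ⟨⟨i, j⟩, ⟨hi, -⟩, rfl⟩
    have hi' : i = k ∨ i = k + 1 := hi
    by_cases hj : j ≤ 0 <;> rcases hi' with rfl | rfl <;> simp [hj]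
  · by_cases hn : n ≤ 0
    · simpa [hn] using ω.2
    · simpa [hn] using ω'.2

/-- The loop obtained from `ω` by staying one unit of time longer at `ω N`. -/
def Loop.delay (ω : A.Loop x₀) (N : ℤ) : A.Loop x₀ :=
  ⟨fun k => if k ≤ N then ω.1 k else ω.1 (k - 1), isMorphism_line_iff.2 fun k => by
    rcases lt_trichotomy k N with h | h | h
    · simpa [h.le, show k + 1 ≤ N from h] using ω.local k
    · subst h
      simpa using (ω.local k).mono (by simp)
    · have := ω.local (k - 1)
      simpa [h.not_ge, show ¬ (k + 1 ≤ N) by omega] using this, by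
    obtain ⟨M, hM⟩ := ω.2.2.1
    refine ⟨M, fun k hk => ?_⟩
    dsimp only
    split_ifs
    · exact hM k hk
    · exact hM _ (by omega), by
    obtain ⟨M, hM⟩ := ω.2.2.2
    refine ⟨M + 1, fun k hk => ?_⟩
    dsimp only
    split_ifs
    · exact hM k (by omega)
    · exact hM _ (by omega)⟩

/-- The time of the delay may be shifted by one: the two loops differ only at the time `N + 1`. -/
theorem Loop.mk_delay_succ (ω : A.Loop x₀) (N : ℤ) :
    (Quot.mk _ (ω.delay N) : A.Pi1 x₀) = Quot.mk _ (ω.delay (N + 1)) := by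
  refine Quot.sound (stablyHomotopic_of_local _ _ fun k => ?_)
  have h1 := ω.local k
  have h2 := ω.local (k - 1)
  simp only [sub_add_cancel] at h2
  simp only [delay]
  rcases lt_trichotomy k N with h | h | h
  · refine h1.mono ?_
    simp [h.le, show k ≤ N + 1 by omega, show k + 1 ≤ N by omega]
  · subst h
    refine h1.mono ?_
    simp
  · rcases (show k = N + 1 ∨ N + 1 < k by omega) with h' | h'
    · subst h'
      refine h2.mono ?_
      simp
    · refine h2.mono ?_
      simp [h.not_ge, show ¬ k ≤ N + 1 by omega, show ¬ k + 1 ≤ N by omega]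

/-- Delaying does not change the class of a loop, as the delay may be shifted to a time when the
loop has become constant. -/
theorem Loop.mk_delay (ω : A.Loop x₀) (N : ℤ) :
    (Quot.mk _ (ω.delay N) : A.Pi1 x₀) = Quot.mk _ ω := by
  obtain ⟨M, hM⟩ := ω.2.2.2
  have hend : (Quot.mk _ (ω.delay M) : A.Pi1 x₀) = Quot.mk _ ω := by
    congr 1
    refine Subtype.ext (funext fun k => ?_)
    simp only [delay]
    split_ifs with h
    · rfl
    · rw [hM k (by omega), hM (k - 1) (by omega)]
  rw [← hend]
  have hstep : ∀ j : ℕ, ∀ N, (Quot.mk _ (ω.delay N) : A.Pi1 x₀) = Quot.mk _ (ω.delay (N + j)) := by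
    intro j
    induction j with
    | zero => intro N; simp
    | succ j ih =>
      intro N
      rw [ih N, mk_delay_succ]
      congr 2
      push_cast
      ring
  rcases le_total N M with h | h
  · rw [hstep (M - N).toNat N]
    congr 2
    omega
  · rw [hstep (N - M).toNat M]
    congr 2
    omega

/-- A point of a loop may be deleted if it lies in one local orbit with its two neighbours. -/
theorem Loop.mk_eq_of_deletion (f g : A.Loop x₀) (N : ℤ) (h1 : ∀ k < N, f.1 k = g.1 k)
    (h2 : ∀ k > N, f.1 k = g.1 (k - 1)) (h : A.Local {f.1 (N - 1), f.1 N, f.1 (N + 1)}) :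
    (Quot.mk _ f : A.Pi1 x₀) = Quot.mk _ g := by
  -- The loops `f` and `g.delay N` differ only at the time `N`.
  rw [← g.mk_delay N]
  have e1 : ∀ k < N, (g.delay N).1 k = f.1 k := fun k hk => by simp [delay, hk.le, h1 k hk]
  have e2 : ∀ k > N, (g.delay N).1 k = f.1 k := fun k hk => by
    simp [delay, not_le.2 hk, h2 k hk]
  have e3 : (g.delay N).1 N = f.1 (N + 1) := by simp [delay, h2 (N + 1) (by omega)]
  refine Quot.sound (stablyHomotopic_of_local _ _ fun k => ?_)
  rcases (show k + 1 < N ∨ k = N - 1 ∨ k = N ∨ N < k by omega) with hk | rfl | rfl | hk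
  · rw [e1 k (by omega), e1 _ hk]
    exact (f.local k).mono (by simp)
  · rw [e1 _ (by omega), sub_add_cancel, e3]
    exact h.mono (by simp [Set.insert_subset_iff])
  · rw [e3, e2 _ (by omega)]
    exact h.mono (by simp)
  · rw [e2 k hk, e2 _ (by omega)]
    exact (f.local k).mono (by simp)

end Deletion

/-! ### The universal cover -/

section Cover

/-- A path starting at `x₀` together with a time `T` from which on it is constant. -/
structure BasedPath (A : GlobalAction.{u, v, w}) (x₀ : A.X) where
  toFun : ℤ → A.X
  T : ℤ
  loc : ∀ k, A.Local {toFun k, toFun (k + 1)}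
  left : ∃ N : ℤ, ∀ k ≤ N, toFun k = x₀
  right : ∀ k ≥ T, toFun k = toFun T

variable {A : GlobalAction.{u, v, w}} {x₀ : A.X}

namespace BasedPath

/-- The path `q` arises from `p` by deleting a point, other than the last one, that lies in one
local orbit with its two neighbours. -/
def Deletion (p q : A.BasedPath x₀) : Prop :=
  q.T = p.T - 1 ∧ ∃ N < p.T, (∀ k < N, p.toFun k = q.toFun k) ∧
    (∀ k > N, p.toFun k = q.toFun (k - 1)) ∧
    A.Local {p.toFun (N - 1), p.toFun N, p.toFun (N + 1)}

/-- The end point of a based path. -/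
def last (p : A.BasedPath x₀) : A.X := p.toFun p.T

/-- Continue the path `p` by one step, to the point `y`. -/
def append (p : A.BasedPath x₀) (y : A.X) (hy : A.Local {p.last, y}) : A.BasedPath x₀ where
  toFun k := if k ≤ p.T then p.toFun k else y
  T := p.T + 1
  loc k := by
    rcases lt_trichotomy k p.T with h | h | h
    · simpa [h.le, show k + 1 ≤ p.T from h] using p.loc k
    · subst h
      simpa [last] using hy
    · simpa [h.not_ge, show ¬ (k + 1 ≤ p.T) by omega] using hy.mono (by simp)
  left := by
    obtain ⟨N, hN⟩ := p.left
    exact ⟨min N p.T, fun k hk => by simp [(le_min_iff.1 hk).2, hN k (le_min_iff.1 hk).1]⟩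
  right k hk := by
    simp [show ¬ (k ≤ p.T) by omega]

theorem append_last (p : A.BasedPath x₀) (y : A.X) (hy : A.Local {p.last, y}) :
    (p.append y hy).last = y := by
  simp [append, last]

theorem Deletion.last_eq {p q : A.BasedPath x₀} (h : p.Deletion q) : p.last = q.last := by
  obtain ⟨hT, N, hN, -, h2, -⟩ := h
  rw [last, last, hT, h2 p.T hN]

theorem Deletion.append {p q : A.BasedPath x₀} (h : p.Deletion q) (y : A.X)
    (hy : A.Local {p.last, y}) (hy' : A.Local {q.last, y}) :
    (p.append y hy).Deletion (q.append y hy') := by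
  obtain ⟨hT, N, hN, h1, h2, h3⟩ := h
  refine ⟨by simp [BasedPath.append, hT], N, by simp only [BasedPath.append]; omega,
    fun k hk => ?_, fun k hk => ?_, ?_⟩
  · simp only [BasedPath.append, if_pos (show k ≤ p.T by omega), if_pos (show k ≤ q.T by omega),
      h1 k hk]
  · simp only [BasedPath.append]
    by_cases hk' : k ≤ p.T
    · rw [if_pos hk', if_pos (by omega), h2 k hk]
    · rw [if_neg hk', if_neg (by omega)]
  · simpa only [BasedPath.append, if_pos (show N - 1 ≤ p.T by omega),
      if_pos (show N ≤ p.T by omega), if_pos (show N + 1 ≤ p.T by omega)] using h3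

/-- A based path which ends at its starting point, as a loop. -/
def toLoop (p : A.BasedPath x₀) (h : p.last = x₀) : A.Loop x₀ :=
  ⟨p.toFun, isMorphism_line_iff.2 p.loc, p.left, p.T, fun k hk => (p.right k hk).trans h⟩

open Classical in
/-- The homotopy class of a based path which is a loop; the value `z` on other paths is
irrelevant. -/
def toPi1 (z : A.Pi1 x₀) (p : A.BasedPath x₀) : A.Pi1 x₀ :=
  if h : p.last = x₀ then Quot.mk _ (p.toLoop h) else z

theorem toPi1_of_loop (z : A.Pi1 x₀) (p : A.BasedPath x₀) (h : p.last = x₀) :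
    p.toPi1 z = Quot.mk _ (p.toLoop h) :=
  dif_pos h

theorem toPi1_of_not_loop (z : A.Pi1 x₀) (p : A.BasedPath x₀) (h : ¬ p.last = x₀) :
    p.toPi1 z = z :=
  dif_neg h

end BasedPath

variable (A x₀) in
/-- The universal cover of `A` at `x₀`: based paths up to the deletion of points which lie in one
local orbit with their neighbours. -/
def Cover : Type u := Quot (BasedPath.Deletion (A := A) (x₀ := x₀))

namespace Cover

/-- The class of a based path. -/
def mk (p : A.BasedPath x₀) : A.Cover x₀ := Quot.mk _ p

/-- The covering projection, which takes the class of a path to its end point. -/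
def last : A.Cover x₀ → A.X := Quot.lift BasedPath.last fun _ _ h => h.last_eq

/-- Continue paths by the step from their end point `x` to `m x`. -/
def step (m : A.X → A.X) (hm : ∀ x, A.Local {x, m x}) : A.Cover x₀ → A.Cover x₀ :=
  Quot.map (fun p => p.append (m p.last) (hm _)) fun p q h => by
    have := h.append (m p.last) (hm _) (by rw [h.last_eq]; exact hm _)
    simpa only [h.last_eq] using this

theorem mk_append (p : A.BasedPath x₀) (m : A.X → A.X) (hm : ∀ x, A.Local {x, m x}) (y : A.X)
    (hy : A.Local {p.last, y}) (h : m p.last = y) :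
    mk (p.append y hy) = step m hm (mk p) := by
  subst h
  rfl

theorem last_step (m : A.X → A.X) (hm : ∀ x, A.Local {x, m x}) (u : A.Cover x₀) :
    (step m hm u).last = m u.last := by
  induction u using Quot.ind with
  | mk p => exact p.append_last _ _

theorem step_eq_self (m : A.X → A.X) (hm : ∀ x, A.Local {x, m x}) (u : A.Cover x₀)
    (h : m u.last = u.last) : step m hm u = u := by
  induction u using Quot.ind with
  | mk p =>
    replace h : m p.last = p.last := h
    have hfun : ∀ k, (p.append (m p.last) (hm _)).toFun k = p.toFun k := fun k => by
      simp only [BasedPath.append]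
      split_ifs with hk
      · rfl
      · rw [h, p.right k (by omega), BasedPath.last]
    refine Quot.sound ⟨by simp [BasedPath.append], p.T, by simp [BasedPath.append],
      fun k _ => hfun k, fun k hk => ?_, ?_⟩
    · rw [hfun, p.right k hk.le, p.right (k - 1) (by omega)]
    · rw [hfun, hfun, hfun, p.right (p.T + 1) (by omega)]
      have := p.loc (p.T - 1)
      rw [sub_add_cancel] at this
      exact this.mono (by simp)

/-- Two successive steps may be replaced by a single one if the three points that they visit lie in
one local orbit. -/
theorem step_step (m m' m'' : A.X → A.X) (hm : ∀ x, A.Local {x, m x})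
    (hm' : ∀ x, A.Local {x, m' x}) (hm'' : ∀ x, A.Local {x, m'' x}) (u : A.Cover x₀)
    (h : m' (m u.last) = m'' u.last) (hloc : A.Local {u.last, m u.last, m'' u.last}) :
    step m' hm' (step m hm u) = step m'' hm'' u := by
  induction u using Quot.ind with
  | mk p =>
    replace h : m' (m p.last) = m'' p.last := h
    replace hloc : A.Local {p.last, m p.last, m'' p.last} := hloc
    have e : m' (p.append (m p.last) (hm _)).last = m'' p.last := by rw [p.append_last, h]
    refine Quot.sound ⟨by simp [BasedPath.append], p.T + 1, by simp [BasedPath.append],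
      fun k hk => ?_, fun k hk => ?_, ?_⟩
    · simp [BasedPath.append, show k ≤ p.T by omega, show k ≤ p.T + 1 by omega]
    · rcases eq_or_lt_of_le (show p.T + 1 + 1 ≤ k by omega) with rfl | hk'
      · simpa [BasedPath.append] using e
      · simpa [BasedPath.append, show ¬ k ≤ p.T + 1 by omega, show ¬ k ≤ p.T by omega,
          show ¬ k ≤ 1 + p.T by omega] using e
    · have e1 : ((p.append (m p.last) (hm _)).append _ (hm' _)).toFun (p.T + 1 - 1) = p.last := by
        simp [BasedPath.append, BasedPath.last]
      have e2 : ((p.append (m p.last) (hm _)).append _ (hm' _)).toFun (p.T + 1) = m p.last := by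
        simp [BasedPath.append]
      have e3 : ((p.append (m p.last) (hm _)).append _ (hm' _)).toFun (p.T + 1 + 1) =
          m'' p.last := by
        rw [← e]
        simp [BasedPath.append]
      rw [e1, e2, e3]
      exact hloc

/-- The homotopy class of a based path which is a loop. -/
def toPi1 (z : A.Pi1 x₀) : A.Cover x₀ → A.Pi1 x₀ :=
  Quot.lift (BasedPath.toPi1 z) fun p q h => by
    by_cases hp : p.last = x₀
    · have hq : q.last = x₀ := h.last_eq ▸ hp
      rw [p.toPi1_of_loop z hp, q.toPi1_of_loop z hq]
      obtain ⟨-, N, -, h1, h2, h3⟩ := h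
      exact Loop.mk_eq_of_deletion (p.toLoop hp) (q.toLoop hq) N h1 h2 h3
    · have hq : ¬ q.last = x₀ := h.last_eq ▸ hp
      rw [p.toPi1_of_not_loop z hp, q.toPi1_of_not_loop z hq]

theorem toPi1_mk (z : A.Pi1 x₀) (ω : A.Loop x₀) (p : A.BasedPath x₀) (h : p.toFun = ω.1) :
    toPi1 z (mk p) = Quot.mk _ ω := by
  have hp : p.last = x₀ := by
    obtain ⟨N, hN⟩ := ω.2.2.2
    rw [BasedPath.last, ← p.right (max p.T N) (le_max_left _ _), h, hN _ (le_max_right _ _)]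
  refine (p.toPi1_of_loop z hp).trans ?_
  congr 1
  exact Subtype.ext h

/-- The constant path at `x₀`, viewed as constant from time `T` on. -/
def constPath (h : A.Local {x₀}) (T : ℤ) : A.BasedPath x₀ where
  toFun _ := x₀
  T := T
  loc _ := by simpa using h
  left := ⟨0, fun _ _ => rfl⟩
  right _ _ := rfl

theorem mk_constPath (h : A.Local {x₀}) (T : ℤ) :
    mk (constPath h T) = mk (constPath h 0) := by
  have key : ∀ T : ℤ, mk (constPath h (T + 1)) =
      mk (constPath h T) := fun T =>
    Quot.sound ⟨by simp [constPath], T, by simp [constPath], fun _ _ => rfl, fun _ _ => rfl,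
      h.mono (by simp [constPath])⟩
  induction T with
  | zero => rfl
  | succ j ih => rw [key, ih]
  | pred j ih => rw [← ih, ← key, sub_add_cancel]

/-- The base point of the universal cover. -/
def base (h : A.Local {x₀}) : A.Cover x₀ := mk (constPath h 0)

/-- The initial part of a loop, up to time `T`. -/
def initialPart (ω : A.Loop x₀) (T : ℤ) : A.BasedPath x₀ where
  toFun k := ω.1 (min k T)
  T := T
  loc k := by
    rcases lt_or_ge k T with h | h
    · rw [min_eq_left h.le, min_eq_left (by omega)]
      exact ω.local k
    · rw [min_eq_right h, min_eq_right (by omega)]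
      exact (ω.local T).mono (by simp)
  left := by
    obtain ⟨N, hN⟩ := ω.2.2.1
    exact ⟨N, fun k hk => hN _ (by omega)⟩
  right k hk := by simp [min_eq_right hk]

theorem mk_initialPart_succ (ω : A.Loop x₀) (T : ℤ) (m : A.X → A.X)
    (hm : ∀ x, A.Local {x, m x}) (h : m (ω.1 T) = ω.1 (T + 1)) :
    mk (initialPart ω (T + 1)) =
      step m hm (mk (initialPart ω T)) := by
  have hl : (initialPart ω T).last = ω.1 T := by simp [initialPart, BasedPath.last]
  rw [← mk_append (initialPart ω T) m hm (ω.1 (T + 1)) (by rw [hl]; exact ω.local T)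
    (by rw [hl, h])]
  congr 1
  simp only [initialPart, BasedPath.append, BasedPath.mk.injEq, and_true]
  funext k
  by_cases hk : k ≤ T
  · exact (congrArg ω.1 (show min k (T + 1) = min k T by omega)).trans (if_pos hk).symm
  · exact (congrArg ω.1 (show min k (T + 1) = T + 1 by omega)).trans (if_neg hk).symm

end Cover

end Cover

end GlobalAction

/-! ### The Steinberg group and its local subgroups -/

section Steinberg

variable {n : ℕ} {R : Type u} [Ring R]

theorem θ_of (p : OffDiag n) (r : R) : θ n R (PresentedGroup.of (p, r)) = elem p r :=
  PresentedGroup.toGroup.of _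

theorem St.induction {q : St n R → Prop} (of : ∀ c, q (PresentedGroup.of c)) (one : q 1)
    (mul : ∀ x y, q x → q y → q (x * y)) (inv : ∀ x, q x → q x⁻¹) (x : St n R) : q x := by
  have hx : x ∈ Subgroup.closure (Set.range (PresentedGroup.of (rels := {x | StRel n R x}))) := by
    rw [PresentedGroup.closure_range_of]
    trivial
  induction hx using Subgroup.closure_induction with
  | mem x hx => obtain ⟨c, rfl⟩ := hx; exact of c
  | one => exact one
  | mul x y _ _ hx hy => exact mul x y hx hy
  | inv x _ hx => exact inv x hx

theorem θ_mem_E (x : St n R) : θ n R x ∈ E n R := by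
  induction x using St.induction with
  | of c => rw [θ_of]; exact Subgroup.subset_closure ⟨_, _, rfl⟩
  | one => rw [map_one]; exact one_mem _
  | mul x y hx hy => rw [map_mul]; exact mul_mem hx hy
  | inv x hx => rw [map_inv]; exact inv_mem hx

theorem exists_θ_eq {g : GL (Fin n) R} (hg : g ∈ E n R) : ∃ x, θ n R x = g := by
  have : E n R ≤ (θ n R).range := by
    refine (Subgroup.closure_le _).2 ?_
    rintro _ ⟨p, r, rfl⟩
    exact ⟨_, θ_of p r⟩
  exact this hg

theorem map_stUnip (α : NilIndex n) : (stUnip R α).map (θ n R) = unip R α := by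
  rw [stUnip, MonoidHom.map_closure, unip_eq_closure]
  congr 1
  ext g
  constructor
  · rintro ⟨_, ⟨p, r, hp, rfl⟩, rfl⟩
    exact ⟨p, r, hp, θ_of p r⟩
  · rintro ⟨p, r, hp, rfl⟩
    exact ⟨_, ⟨p, r, hp, rfl⟩, θ_of p r⟩

theorem θ_mem_unip {α : NilIndex n} {a : St n R} (ha : a ∈ stUnip R α) : θ n R a ∈ unip R α :=
  map_stUnip (R := R) α ▸ Subgroup.mem_map_of_mem _ ha

theorem exists_mem_stUnip {α : NilIndex n} {g : GL (Fin n) R} (hg : g ∈ unip R α) :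
    ∃ a ∈ stUnip R α, θ n R a = g := by
  rwa [← map_stUnip] at hg

theorem of_mem_stUnip {α : NilIndex n} {p : OffDiag n} (hp : p.1 ∈ α.carrier) (r : R) :
    (PresentedGroup.of (p, r) : St n R) ∈ stUnip R α :=
  Subgroup.subset_closure ⟨p, r, hp, rfl⟩

/-- The nilpotent set consisting of two positions that do not interact. -/
def NilIndex.pair (p q : OffDiag n) (h1 : p.1.2 ≠ q.1.1) (h2 : p.1.1 ≠ q.1.2) : NilIndex n where
  carrier := {p.1, q.1}
  off_diag i j h := by
    rcases h with h | h
    · exact fun e => p.2 (by rw [← h]; exact e)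
    · exact fun e => q.2 (by rw [← (show (i, j) = q.1 from h)]; exact e)
  asymm i j h h' := by
    obtain ⟨⟨p1, p2⟩, hp⟩ := p
    obtain ⟨⟨q1, q2⟩, hq⟩ := q
    simp only [Set.mem_insert_iff, Set.mem_singleton_iff, Prod.mk.injEq] at *
    grind
  trans i j k h h' := by
    obtain ⟨⟨p1, p2⟩, hp⟩ := p
    obtain ⟨⟨q1, q2⟩, hq⟩ := q
    simp only [Set.mem_insert_iff, Set.mem_singleton_iff, Prod.mk.injEq] at *
    grind

/-- The nilpotent set consisting of a single position. -/
def NilIndex.single (p : OffDiag n) : NilIndex n :=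
  .pair p p p.2.symm p.2

/-- The nilpotent set `{(i, j), (j, l), (i, l)}`. -/
def NilIndex.triangle {i j l : Fin n} (hij : i ≠ j) (hjl : j ≠ l) (hil : i ≠ l) : NilIndex n where
  carrier := {(i, j), (j, l), (i, l)}
  off_diag a b h := by
    simp only [Set.mem_insert_iff, Set.mem_singleton_iff, Prod.mk.injEq] at *
    grind
  asymm a b h h' := by
    simp only [Set.mem_insert_iff, Set.mem_singleton_iff, Prod.mk.injEq] at *
    grind
  trans a b c h h' := by
    simp only [Set.mem_insert_iff, Set.mem_singleton_iff, Prod.mk.injEq] at *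
    grind

theorem St.of_add (p : OffDiag n) (r s : R) :
    (PresentedGroup.of (p, r) * PresentedGroup.of (p, s) : St n R) =
      PresentedGroup.of (p, r + s) :=
  mul_inv_eq_one.1 (PresentedGroup.one_of_mem (StRel.add p r s))

open scoped commutatorElement in
theorem St.of_comm_one {p q : OffDiag n} (h1 : p.1.2 ≠ q.1.1) (h2 : p.1.1 ≠ q.1.2) (r s : R) :
    (PresentedGroup.of (p, r) * PresentedGroup.of (q, s) : St n R) =
      PresentedGroup.of (q, s) * PresentedGroup.of (p, r) :=
  commutatorElement_eq_one_iff_mul_comm.1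
    (PresentedGroup.one_of_mem (StRel.comm_one p q h1 h2 r s))

open scoped commutatorElement in
theorem St.of_comm {i j l : Fin n} (hij : i ≠ j) (hjl : j ≠ l) (hil : i ≠ l) (r s : R) :
    (PresentedGroup.of (⟨(i, j), hij⟩, r) * PresentedGroup.of (⟨(j, l), hjl⟩, s) : St n R) =
      PresentedGroup.of (⟨(i, l), hil⟩, r * s) * PresentedGroup.of (⟨(j, l), hjl⟩, s) *
        PresentedGroup.of (⟨(i, j), hij⟩, r) := by
  have := PresentedGroup.one_of_mem (rels := {x | StRel n R x}) (StRel.comm i j l hij hjl hil r s)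
  rw [map_mul, map_inv, map_commutatorElement, mul_inv_eq_one, commutatorElement_def] at this
  rw [← mul_inv_eq_iff_eq_mul, ← mul_inv_eq_iff_eq_mul]
  exact this

end Steinberg

/-! ### The action of the Steinberg group on the universal cover -/

section Action

variable {m : ℕ} {R : Type u} [Ring R]

open GlobalAction

/-- The underlying unimodular row of a point of the elementary unimodular row action. -/
def row (v : (eumAction m R).X) : Um R (m + 1) := (show EUm m R from v).1

theorem row_injective : Function.Injective (row (m := m) (R := R)) := Subtype.val_injective

/-- The right action of the Steinberg group on elementary unimodular rows through `θ`. -/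
def stAct (v : (eumAction m R).X) (x : St (m + 1) R) : (eumAction m R).X :=
  (⟨(row v).act (θ (m + 1) R x), by
    obtain ⟨ε, hε, h⟩ := (show EUm m R from v).2
    exact ⟨ε * θ (m + 1) R x, mul_mem hε (θ_mem_E x), by rw [Um.act_mul, h]; rfl⟩⟩ : EUm m R)

theorem row_stAct (v : (eumAction m R).X) (x : St (m + 1) R) :
    row (stAct v x) = (row v).act (θ (m + 1) R x) := rfl

theorem stAct_one (v : (eumAction m R).X) : stAct v 1 = v :=
  row_injective (by rw [row_stAct, map_one, Um.act_one])

theorem stAct_mul (v : (eumAction m R).X) (x y : St (m + 1) R) :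
    stAct v (x * y) = stAct (stAct v x) y :=
  row_injective (by rw [row_stAct, map_mul, Um.act_mul, row_stAct, row_stAct])

theorem stAct_eBase_eq_iff {x : St (m + 1) R} : stAct (eBase m R) x = eBase m R ↔ x ∈ Pt m R :=
  ⟨fun h => ⟨congrArg row h, θ_mem_E x⟩, fun h => row_injective h.1⟩

theorem eum_orb_iff {α : NilIndex (m + 1)} {v w : (eumAction m R).X} :
    (eumAction m R).Orb α v w ↔ ∃ a ∈ stUnip R α, stAct v a = w := by
  constructor
  · rintro ⟨-, ⟨g, hg⟩, rfl⟩
    obtain ⟨a, ha, h⟩ := exists_mem_stUnip (Subgroup.mem_subgroupOf.1 hg)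
    refine ⟨a, ha, row_injective ?_⟩
    rw [row_stAct, h]
    rfl
  · rintro ⟨a, ha, rfl⟩
    exact ⟨trivial, ⟨⟨θ _ R a, θ_mem_E a⟩, Subgroup.mem_subgroupOf.2 (θ_mem_unip ha)⟩, rfl⟩

theorem eum_local_of {α : NilIndex (m + 1)} (v : (eumAction m R).X) {s : Set (eumAction m R).X}
    (h : ∀ w ∈ s, ∃ a ∈ stUnip R α, stAct v a = w) : (eumAction m R).Local s :=
  local_of_orb fun w hw => eum_orb_iff.2 (h w hw)

theorem exists_of_eum_local {v : (eumAction m R).X} {s : Set (eumAction m R).X}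
    (h : (eumAction m R).Local s) (hv : v ∈ s) :
    ∃ α : NilIndex (m + 1), ∀ w ∈ s, ∃ a ∈ stUnip R α, stAct v a = w := by
  obtain ⟨α, hα⟩ := h
  exact ⟨α, fun w hw => eum_orb_iff.1 (hα v hv w hw)⟩

theorem st_local_iff {n : ℕ} {x y : St n R} : (stAction n R).Local ({x, y} : Set (St n R)) ↔
    ∃ α : NilIndex n, ∃ a ∈ stUnip R α, x * a = y := by
  constructor
  · rintro ⟨α, hα⟩
    obtain ⟨_, ⟨g, hg⟩, h⟩ := hα x (Or.inl rfl) y (Or.inr rfl)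
    exact ⟨α, g, hg, h⟩
  · rintro ⟨α, a, ha, rfl⟩
    refine local_of_orb (a := α) (x := x) ?_
    rintro y (rfl | rfl)
    · exact Orb.refl trivial
    · exact ⟨trivial, ⟨a, ha⟩, rfl⟩

theorem eum_local_singleton (v : (eumAction m R).X) : (eumAction m R).Local {v} := by
  obtain ⟨α⟩ := (inferInstance : Nonempty (NilIndex (m + 1)))
  refine eum_local_of (α := α) v ?_
  rintro w rfl
  exact ⟨1, one_mem _, stAct_one _⟩

/-- The elements of the local subgroups of the Steinberg group. -/
def IsLocal {n : ℕ} (a : St n R) : Prop := ∃ α : NilIndex n, a ∈ stUnip R α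

theorem IsLocal.of_mem {n : ℕ} {α : NilIndex n} {a : St n R} (h : a ∈ stUnip R α) : IsLocal a :=
  ⟨α, h⟩

theorem IsLocal.inv {n : ℕ} {a : St n R} (h : IsLocal a) : IsLocal a⁻¹ := by
  obtain ⟨α, h⟩ := h
  exact ⟨α, inv_mem h⟩

theorem isLocal_of {n : ℕ} (c : OffDiag n × R) : IsLocal (PresentedGroup.of c : St n R) :=
  ⟨.single c.1, of_mem_stUnip (show c.1.1 ∈ (NilIndex.single c.1).carrier from Or.inl rfl) c.2⟩

theorem IsLocal.local_stAct {a : St (m + 1) R} (h : IsLocal a) (v : (eumAction m R).X) :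
    (eumAction m R).Local {v, stAct v a} := by
  obtain ⟨α, ha⟩ := h
  refine eum_local_of (α := α) v ?_
  rintro w (rfl | rfl)
  · exact ⟨1, one_mem _, stAct_one _⟩
  · exact ⟨a, ha, rfl⟩

/-- Prolong paths by one step, from their end point `v` to `v θ(a)`, for a local element
`a` of the Steinberg group. -/
def localStep (a : St (m + 1) R) (ha : IsLocal a) :
    (eumAction m R).Cover (eBase m R) → (eumAction m R).Cover (eBase m R) :=
  Cover.step (stAct · a) ha.local_stAct

theorem localStep_one (h : IsLocal (1 : St (m + 1) R)) (u : (eumAction m R).Cover (eBase m R)) :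
    localStep 1 h u = u :=
  Cover.step_eq_self _ _ _ (stAct_one _)

theorem localStep_localStep {α : NilIndex (m + 1)} {a b : St (m + 1) R} (ha : a ∈ stUnip R α)
    (hb : b ∈ stUnip R α) (u : (eumAction m R).Cover (eBase m R)) :
    localStep b (.of_mem hb) (localStep a (.of_mem ha) u) =
      localStep (a * b) (.of_mem (mul_mem ha hb)) u := by
  refine Cover.step_step _ _ _ _ _ _ u (stAct_mul _ _ _).symm (eum_local_of (α := α) u.last ?_)
  rintro w (rfl | rfl | rfl)
  · exact ⟨1, one_mem _, stAct_one _⟩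
  · exact ⟨a, ha, rfl⟩
  · exact ⟨a * b, mul_mem ha hb, rfl⟩

/-- Steps by `a` and `b`, possibly from different local subgroups, cancel if they lead back to the
end point of the path: the three points visited are only two, and lie in one orbit. -/
theorem localStep_cancel {a b : St (m + 1) R} (ha : IsLocal a) (hb : IsLocal b)
    (u : (eumAction m R).Cover (eBase m R)) (h : stAct u.last (a * b) = u.last) :
    localStep b hb (localStep a ha u) = u := by
  have hid : ∀ v, (eumAction m R).Local {v, id v} := fun v =>
    (eum_local_singleton v).mono (by simp)
  rw [stAct_mul] at h
  refine (Cover.step_step _ _ id _ _ hid u h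
    ((ha.local_stAct u.last).mono (by simp [Set.insert_subset_iff]))).trans ?_
  exact Cover.step_eq_self _ _ _ rfl

/-- A local element of the Steinberg group, as a permutation of the universal cover. -/
def localPerm (a : St (m + 1) R) (ha : IsLocal a) :
    Equiv.Perm ((eumAction m R).Cover (eBase m R)) where
  toFun := localStep a ha
  invFun := localStep a⁻¹ ha.inv
  left_inv u := localStep_cancel _ _ u (by rw [mul_inv_cancel, stAct_one])
  right_inv u := localStep_cancel _ _ u (by rw [inv_mul_cancel, stAct_one])

theorem op_localPerm_mul {α : NilIndex (m + 1)} {a b : St (m + 1) R} (ha : a ∈ stUnip R α)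
    (hb : b ∈ stUnip R α) (ha' : IsLocal a) (hb' : IsLocal b) :
    MulOpposite.op (localPerm a ha') * MulOpposite.op (localPerm b hb') =
      MulOpposite.op (localPerm (a * b) (.of_mem (mul_mem ha hb))) :=
  congrArg MulOpposite.op (Equiv.ext fun u => localStep_localStep ha hb u)

theorem localPerm_congr {a b : St (m + 1) R} (h : a = b) (ha : IsLocal a) (hb : IsLocal b) :
    localPerm a ha = localPerm b hb := by
  subst h
  rfl

variable (m R) in
/-- The right action of the Steinberg group on the universal cover. It exists because the elements
occurring in a defining relation lie in a common local subgroup. -/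
def coverHom : St (m + 1) R →* (Equiv.Perm ((eumAction m R).Cover (eBase m R)))ᵐᵒᵖ :=
  PresentedGroup.toGroup
    (f := fun c => MulOpposite.op (localPerm (PresentedGroup.of c) (isLocal_of c))) (by
    rintro x (⟨p, r, s⟩ | ⟨p, q, h1, h2, r, s⟩ | ⟨i, j, l, hij, hjl, hil, r, s⟩)
    · have hp : p.1 ∈ (NilIndex.single p).carrier := Or.inl rfl
      simp only [map_mul, map_inv, FreeGroup.lift_apply_of, mul_inv_eq_one]
      rw [op_localPerm_mul (of_mem_stUnip hp r) (of_mem_stUnip hp s)]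
      exact congrArg _ (localPerm_congr (St.of_add p r s) _ _)
    · have hp : p.1 ∈ (NilIndex.pair p q h1 h2).carrier := Or.inl rfl
      have hq : q.1 ∈ (NilIndex.pair p q h1 h2).carrier := Or.inr rfl
      simp only [map_commutatorElement, FreeGroup.lift_apply_of,
        commutatorElement_eq_one_iff_mul_comm]
      rw [op_localPerm_mul (of_mem_stUnip hp r) (of_mem_stUnip hq s),
        op_localPerm_mul (of_mem_stUnip hq s) (of_mem_stUnip hp r)]
      exact congrArg _ (localPerm_congr (St.of_comm_one h1 h2 r s) _ _)
    · have h1 : (i, j) ∈ (NilIndex.triangle hij hjl hil).carrier := Or.inl rfl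
      have h2 : (j, l) ∈ (NilIndex.triangle hij hjl hil).carrier := Or.inr (Or.inl rfl)
      have h3 : (i, l) ∈ (NilIndex.triangle hij hjl hil).carrier := Or.inr (Or.inr rfl)
      have m1 := of_mem_stUnip (p := ⟨(i, j), hij⟩) h1 r
      have m2 := of_mem_stUnip (p := ⟨(j, l), hjl⟩) h2 s
      have m3 := of_mem_stUnip (p := ⟨(i, l), hil⟩) h3 (r * s)
      simp only [map_mul, map_inv, FreeGroup.lift_apply_of, mul_inv_eq_one,
        commutatorElement_def]
      rw [mul_inv_eq_iff_eq_mul, mul_inv_eq_iff_eq_mul, op_localPerm_mul m1 m2,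
        op_localPerm_mul m3 m2, op_localPerm_mul (mul_mem m3 m2) m1]
      exact congrArg _ (localPerm_congr (St.of_comm hij hjl hil r s) _ _))

/-- The right action of the Steinberg group on the universal cover. -/
def coverAct (u : (eumAction m R).Cover (eBase m R)) (x : St (m + 1) R) :
    (eumAction m R).Cover (eBase m R) :=
  (coverHom m R x).unop u

theorem coverAct_one (u : (eumAction m R).Cover (eBase m R)) : coverAct u 1 = u := by
  simp [coverAct]

theorem coverAct_mul (u : (eumAction m R).Cover (eBase m R)) (x y : St (m + 1) R) :
    coverAct u (x * y) = coverAct (coverAct u x) y := by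
  simp [coverAct]

theorem coverAct_of (u : (eumAction m R).Cover (eBase m R)) (c : OffDiag (m + 1) × R) :
    coverAct u (PresentedGroup.of c) = localStep _ (isLocal_of c) u := by
  simp only [coverAct, coverHom, PresentedGroup.toGroup.of]
  rfl

theorem last_coverAct (u : (eumAction m R).Cover (eBase m R)) (x : St (m + 1) R) :
    (coverAct u x).last = stAct u.last x := by
  induction x using St.induction generalizing u with
  | of c => rw [coverAct_of]; exact Cover.last_step _ _ u
  | one => rw [coverAct_one, stAct_one]
  | mul x y hx hy => rw [coverAct_mul, hy, hx, stAct_mul]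
  | inv x hx =>
    have := hx (coverAct u x⁻¹)
    rw [← coverAct_mul, inv_mul_cancel, coverAct_one] at this
    rw [this, ← stAct_mul, mul_inv_cancel, stAct_one]

/-- A local element acts on the universal cover by a single step, although it may be a long product
of generators. -/
theorem coverAct_local {α : NilIndex (m + 1)} {a : St (m + 1) R} (ha : a ∈ stUnip R α)
    (u : (eumAction m R).Cover (eBase m R)) : coverAct u a = localStep a (.of_mem ha) u := by
  unfold stUnip at ha
  induction ha using Subgroup.closure_induction generalizing u with
  | mem x hx => obtain ⟨p, r, hp, rfl⟩ := hx; exact coverAct_of u (p, r)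
  | one => exact (coverAct_one u).trans (localStep_one _ u).symm
  | mul x y hx hy ihx ihy => rw [coverAct_mul, ihx, ihy, localStep_localStep hx hy]
  | inv x hx ih =>
    have := ih (coverAct u x⁻¹)
    rw [← coverAct_mul, inv_mul_cancel, coverAct_one] at this
    conv_rhs => rw [this]
    exact ((localPerm x (.of_mem hx)).left_inv _).symm

theorem Pt2_le_Pt : Pt2 m R ≤ Pt m R := (Subgroup.closure_le _).2 fun _ h => h.1

/-- The subgroup `(P̃_n(R))₂` acts trivially on the fibre of the universal cover over `e`: a
product of two local elements which fixes the end point of a path prolongs it by going back and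
forth along one step. -/
theorem coverAct_Pt2 {x : St (m + 1) R} (hx : x ∈ Pt2 m R)
    (u : (eumAction m R).Cover (eBase m R)) (hu : u.last = eBase m R) : coverAct u x = u := by
  unfold Pt2 at hx
  induction hx using Subgroup.closure_induction with
  | mem g hg =>
    obtain ⟨hg, x, α, β, a, ha, b, hb, rfl⟩ := hg
    have key : coverAct (coverAct (coverAct u x⁻¹) a) b = coverAct u x⁻¹ := by
      rw [coverAct_local ha, coverAct_local hb]
      refine localStep_cancel _ _ _ ?_
      rw [last_coverAct, hu]
      have := stAct_eBase_eq_iff.2 hg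
      conv_rhs => rw [← this, ← stAct_mul, mul_inv_cancel_right]
      rw [← stAct_mul, ← mul_assoc]
    rw [coverAct_mul, coverAct_mul, coverAct_mul, key, ← coverAct_mul, inv_mul_cancel,
      coverAct_one]
  | one => rw [coverAct_one]
  | mul x y _ _ hx hy => rw [coverAct_mul, hx, hy]
  | inv x _ hx =>
    conv_lhs => rw [← hx]
    rw [← coverAct_mul, mul_inv_cancel, coverAct_one]

variable (m R) in
/-- The base point of the universal cover of the elementary unimodular rows. -/
def coverBase : (eumAction m R).Cover (eBase m R) := Cover.base (eum_local_singleton _)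

/-- The class of the loop in the elementary unimodular rows obtained by moving the base point of
the universal cover by an element of the Steinberg group. -/
def loopClass (x : St (m + 1) R) : Pi1EUm m R :=
  Cover.toPi1 (pi1Base m R) (coverAct (coverBase m R) x)

theorem last_coverBase : (coverBase m R).last = eBase m R := rfl

theorem loopClass_mul_of_mem_Pt2 {x y : St (m + 1) R} (hx : x ∈ Pt2 m R) :
    loopClass (x * y) = loopClass y := by
  rw [loopClass, coverAct_mul, coverAct_Pt2 hx _ last_coverBase, loopClass]

/-- The homotopy class of a loop is determined by the end point of any of its lifts to the
Steinberg group. -/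
theorem loopClass_eq_of_liftsTo {ω : (eumAction m R).Loop (eBase m R)} {x : St (m + 1) R}
    (h : LiftsTo m R ω x) : loopClass x = Quot.mk _ ω := by
  obtain ⟨s, ⟨hs, ⟨N, hN⟩, M, hM⟩, hω⟩ := h
  replace hs := isMorphism_line_iff.1 hs
  replace hω : ∀ k, ω.1 k = stAct (eBase m R) (s k) := fun k => row_injective (hω k)
  have hstart : ω.1 N = eBase m R := by rw [hω, hN N le_rfl, stAct_one]
  have key : ∀ k ≥ N, Cover.mk (Cover.initialPart ω k) =
      coverAct (coverBase m R) (s k) := by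
    intro k hk
    induction k, hk using Int.leInduction with
    | base =>
      rw [hN N le_rfl, coverAct_one, coverBase, Cover.base, ← Cover.mk_constPath _ N]
      congr 1
      simp only [Cover.initialPart, Cover.constPath, BasedPath.mk.injEq, and_true]
      funext k
      exact (hω _).trans (by rw [hN _ (min_le_right _ _), stAct_one])
    | succ k hk ih =>
      obtain ⟨α, a, ha, h⟩ := st_local_iff.1 (hs k)
      rw [← h, coverAct_mul, ← ih, coverAct_local ha]
      refine Cover.mk_initialPart_succ ω k _ _ ?_
      rw [hω, hω, ← stAct_mul, h]
  obtain ⟨L, hL⟩ := ω.2.2.2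
  -- From the time `K` on, both the loop and its lift are constant.
  let K := max N (max M L)
  rw [loopClass, ← hM K (by omega), ← key K (by omega)]
  refine Cover.toPi1_mk _ ω _ (funext fun k => ?_)
  rcases le_total k K with h | h
  · exact congrArg ω.1 (min_eq_left h)
  · refine (congrArg ω.1 (min_eq_right h)).trans ?_
    rw [hL K (by omega), hL k (by omega)]

end Action

/-! ### Lifting loops to the Steinberg group -/

section Lifting

variable {m : ℕ} {R : Type u} [Ring R]

open GlobalAction

/-- `(P̃_n(R))₂` is normal in `P̃_n(R)`. -/
theorem conj_mem_Pt2 {g y : St (m + 1) R} (hg : g ∈ Pt2 m R) (hy : y ∈ Pt m R) :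
    y⁻¹ * g * y ∈ Pt2 m R := by
  unfold Pt2 at hg
  induction hg using Subgroup.closure_induction with
  | mem g hg =>
    obtain ⟨hg, x, α, β, a, ha, b, hb, rfl⟩ := hg
    exact Subgroup.subset_closure ⟨mul_mem (mul_mem (inv_mem hy) hg) hy, x * y, α, β, a, ha, b, hb,
      by group⟩
  | one => simp
  | mul g h _ _ ihg ihh => simpa [mul_assoc] using mul_mem ihg ihh
  | inv g _ ih => simpa [mul_assoc] using inv_mem ih

/-- Two elements of the Steinberg group represent the same point of the covering
`(P̃_n(R))₂ \ St_n(R) → EUm_n(R)`. -/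
def SameCoset (x y : St (m + 1) R) : Prop := y * x⁻¹ ∈ Pt2 m R

namespace SameCoset

variable {x y z : St (m + 1) R}

theorem refl (x : St (m + 1) R) : SameCoset x x := by simp [SameCoset]

theorem symm (h : SameCoset x y) : SameCoset y x := by simpa [SameCoset] using inv_mem h

theorem trans (h : SameCoset x y) (h' : SameCoset y z) : SameCoset x z := by
  simpa [SameCoset] using mul_mem h' h

theorem mul_right (h : SameCoset x y) (g : St (m + 1) R) : SameCoset (x * g) (y * g) := by
  simpa [SameCoset] using h

theorem stAct_eq (h : SameCoset x y) : stAct (eBase m R) x = stAct (eBase m R) y := by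
  have := stAct_eBase_eq_iff.2 (Pt2_le_Pt h)
  conv_lhs => rw [← this, ← stAct_mul, inv_mul_cancel_right]

/-- Local lifts to the covering are unique. -/
theorem of_stAct_eq {a b : St (m + 1) R} (ha : IsLocal a) (hb : IsLocal b)
    (h : stAct (eBase m R) (x * a) = stAct (eBase m R) (x * b)) :
    SameCoset (x * a) (x * b) := by
  obtain ⟨α, ha⟩ := ha
  obtain ⟨β, hb⟩ := hb
  refine Subgroup.subset_closure ⟨stAct_eBase_eq_iff.1 ?_, x⁻¹, β, α, b, hb, a⁻¹, inv_mem ha,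
    by group⟩
  rw [stAct_mul, ← h, ← stAct_mul, mul_inv_cancel, stAct_one]

theorem of_mem_Pt (hx : x ∈ Pt m R) (h : SameCoset x y) : x⁻¹ * y ∈ Pt2 m R := by
  simpa [mul_assoc] using conj_mem_Pt2 h hx

end SameCoset

/-- Lifts of adjacent rows of a homotopy remain adjacent in the covering. -/
theorem exists_local_of_lifts {s s' : ℤ → St (m + 1) R} {N : ℤ}
    (hs : ∀ k, ∃ a, IsLocal a ∧ s k * a = s (k + 1))
    (hs' : ∀ k, ∃ a, IsLocal a ∧ s' k * a = s' (k + 1)) (h : s N = s' N)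
    (hloc : ∀ k, (eumAction m R).Local {stAct (eBase m R) (s k), stAct (eBase m R) (s (k + 1)),
      stAct (eBase m R) (s' k), stAct (eBase m R) (s' (k + 1))}) (k : ℤ) (hk : N ≤ k) :
    ∃ a, IsLocal a ∧ SameCoset (s k * a) (s' k) := by
  induction k, hk using Int.leInduction with
  | base =>
    obtain ⟨α⟩ := (inferInstance : Nonempty (NilIndex (m + 1)))
    exact ⟨1, ⟨α, one_mem _⟩, by rw [mul_one, h]; exact .refl _⟩
  | succ k hk ih =>
    obtain ⟨a, ha, hsa⟩ := ih
    obtain ⟨c, hc, hsc⟩ := hs k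
    obtain ⟨d, hd, hsd⟩ := hs' k
    obtain ⟨β, hβ⟩ := exists_of_eum_local (hloc k) (Or.inl rfl)
    obtain ⟨g, hg, hsg⟩ := hβ _ (Or.inr (Or.inl rfl))
    obtain ⟨v, hv, hsv⟩ := hβ _ (Or.inr (Or.inr (Or.inl rfl)))
    obtain ⟨w, hw, hsw⟩ := hβ _ (Or.inr (Or.inr (Or.inr rfl)))
    rw [← stAct_mul] at hsg hsv hsw
    -- All the four corners are reached from `s k` by elements `1, g, v, w` of one local group, and
    -- these lifts agree with those on the two rows by uniqueness.
    have h1 : SameCoset (s k * v) (s' k) :=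
      (SameCoset.of_stAct_eq ⟨β, hv⟩ ha (hsv.trans hsa.stAct_eq.symm)).trans hsa
    have h2 : SameCoset (s k * g) (s (k + 1)) := by
      rw [← hsc]
      exact SameCoset.of_stAct_eq ⟨β, hg⟩ hc (by rw [hsg, hsc])
    have h3 : SameCoset (s k * v * (v⁻¹ * w)) (s k * v * d) := by
      refine SameCoset.of_stAct_eq ⟨β, mul_mem (inv_mem hv) hw⟩ hd ?_
      rw [mul_assoc, mul_inv_cancel_left, hsw, ← hsd]
      exact (h1.mul_right d).stAct_eq.symm
    rw [mul_assoc, mul_inv_cancel_left] at h3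
    refine ⟨g⁻¹ * w, ⟨β, mul_mem (inv_mem hg) hw⟩, ?_⟩
    have h4 := h2.symm.mul_right (g⁻¹ * w)
    rw [mul_assoc (s k), mul_inv_cancel_left] at h4
    rw [← hsd]
    exact h4.trans (h3.trans (h1.mul_right d))

/-- The definition of `LiftsTo`, with the steps of the lifted path made explicit. -/
theorem LiftsTo.exists_lift {ω : (eumAction m R).Loop (eBase m R)} {x : St (m + 1) R}
    (h : LiftsTo m R ω x) : ∃ s : ℤ → St (m + 1) R,
      (∀ k, ∃ a, IsLocal a ∧ s k * a = s (k + 1)) ∧ (∃ N, ∀ k ≤ N, s k = 1) ∧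
      (∃ N, ∀ k ≥ N, s k = x) ∧ ∀ k, ω.1 k = stAct (eBase m R) (s k) := by
  obtain ⟨s, ⟨hs, hN, hM⟩, hω⟩ := h
  refine ⟨s, fun k => ?_, hN, hM, fun k => row_injective (hω k)⟩
  obtain ⟨α, a, ha, h⟩ := st_local_iff.1 (isMorphism_line_iff.1 hs k)
  exact ⟨a, ⟨α, ha⟩, h⟩

theorem LiftsTo.mem_Pt {ω : (eumAction m R).Loop (eBase m R)} {x : St (m + 1) R}
    (h : LiftsTo m R ω x) : x ∈ Pt m R := by
  obtain ⟨s, -, -, ⟨M, hM⟩, hω⟩ := h.exists_lift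
  obtain ⟨L, hL⟩ := ω.2.2.2
  rw [← stAct_eBase_eq_iff, ← hM (max M L) (le_max_left _ _), ← hω, hL _ (le_max_right _ _)]

/-- Lifts of two loops which can be stacked as adjacent rows end in the same coset. -/
theorem LiftsTo.sameCoset {ω ω' : (eumAction m R).Loop (eBase m R)} {x y : St (m + 1) R}
    (hx : LiftsTo m R ω x) (hy : LiftsTo m R ω' y)
    (h : ∀ k, (eumAction m R).Local {ω.1 k, ω.1 (k + 1), ω'.1 k, ω'.1 (k + 1)}) :
    SameCoset x y := by
  have hx' := stAct_eBase_eq_iff.2 hx.mem_Pt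
  have hy' := stAct_eBase_eq_iff.2 hy.mem_Pt
  obtain ⟨s, hs, ⟨N, hN⟩, ⟨M, hM⟩, hω⟩ := hx.exists_lift
  obtain ⟨s', hs', ⟨N', hN'⟩, ⟨M', hM'⟩, hω'⟩ := hy.exists_lift
  simp only [hω, hω'] at h
  obtain ⟨a, ha, hxy⟩ := exists_local_of_lifts (N := min N N') hs hs'
    (by rw [hN _ (by omega), hN' _ (by omega)]) h (max (min N N') (max M M')) (le_max_left _ _)
  rw [hM _ (by omega), hM' _ (by omega)] at hxy
  have h1 : IsLocal (1 : St (m + 1) R) := ha.imp fun α _ => one_mem _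
  have : SameCoset (x * 1) (x * a) := SameCoset.of_stAct_eq h1 ha
    (by rw [mul_one, hxy.stAct_eq, hx', hy'])
  rw [mul_one] at this
  exact this.trans hxy

theorem exists_basedPath {n : ℕ} (x : St n R) :
    ∃ p : (stAction n R).BasedPath (1 : St n R), p.last = x := by
  have step : ∀ x a : St n R, IsLocal a →
      (∃ p : (stAction n R).BasedPath (1 : St n R), p.last = x) →
      ∃ p : (stAction n R).BasedPath (1 : St n R), p.last = x * a := by
    rintro x a ⟨α, ha⟩ ⟨p, hp⟩
    exact ⟨p.append (x * a : St n R) (hp ▸ st_local_iff.2 ⟨α, a, ha, rfl⟩), p.append_last _ _⟩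
  have hx : x ∈ Subgroup.closure (Set.range (PresentedGroup.of (rels := {x | StRel n R x}))) := by
    rw [PresentedGroup.closure_range_of]
    trivial
  induction hx using Subgroup.closure_induction_right with
  | one =>
    obtain ⟨α⟩ := (inferInstance : Nonempty (NilIndex n))
    exact ⟨⟨fun _ => (1 : St n R), 0, fun _ => st_local_iff.2 ⟨α, 1, one_mem _, mul_one _⟩,
      ⟨0, fun _ _ => rfl⟩, fun _ _ => rfl⟩, rfl⟩
  | mul_right x _ y hy ih =>
    obtain ⟨c, rfl⟩ := hy
    exact step _ _ (isLocal_of c) ih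
  | mul_inv_cancel x _ y hy ih =>
    obtain ⟨c, rfl⟩ := hy
    exact step _ _ (isLocal_of c).inv ih

theorem exists_loop_of_mem_Pt {x : St (m + 1) R} (hx : x ∈ Pt m R) :
    ∃ ω, LiftsTo m R ω x := by
  obtain ⟨p, hp⟩ := exists_basedPath x
  let s : ℤ → St (m + 1) R := p.toFun
  have hright : ∀ k ≥ p.T, s k = x := fun k hk => (p.right k hk).trans hp
  refine ⟨⟨fun k => stAct (eBase m R) (s k), isMorphism_line_iff.2 fun k => ?_, ?_, ?_⟩, s,
    ⟨isMorphism_line_iff.2 p.loc, p.left, p.T, hright⟩, fun k => rfl⟩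
  · obtain ⟨α, a, ha, h⟩ := st_local_iff.1 (p.loc k)
    replace h : s k * a = s (k + 1) := h
    change (eumAction m R).Local {stAct (eBase m R) (s k), stAct (eBase m R) (s (k + 1))}
    rw [← h, stAct_mul]
    exact IsLocal.local_stAct ⟨α, ha⟩ _
  · obtain ⟨N, hN⟩ := p.left
    exact ⟨N, fun k hk => (congrArg _ (hN k hk)).trans (stAct_one _)⟩
  · exact ⟨p.T, fun k hk => (congrArg _ (hright k hk)).trans (stAct_eBase_eq_iff.2 hx)⟩

theorem exists_liftsTo (ω : (eumAction m R).Loop (eBase m R)) : ∃ x, LiftsTo m R ω x := by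
  obtain ⟨α₀⟩ := (inferInstance : Nonempty (NilIndex (m + 1)))
  -- Where the loop stays at a point, its lift must stay too, in order to become constant.
  have hstep : ∀ k, ∃ a : St (m + 1) R, IsLocal a ∧ stAct (ω.1 k) a = ω.1 (k + 1) ∧
      (ω.1 k = ω.1 (k + 1) → a = 1) := by
    intro k
    by_cases h : ω.1 k = ω.1 (k + 1)
    · exact ⟨1, ⟨α₀, one_mem _⟩, (stAct_one _).trans h, fun _ => rfl⟩
    · obtain ⟨α, hα⟩ := exists_of_eum_local (ω.local k) (Or.inl rfl)
      obtain ⟨a, ha, ha'⟩ := hα _ (Or.inr rfl)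
      exact ⟨a, ⟨α, ha⟩, ha', fun h' => absurd h' h⟩
  choose a ha hω ha1 using hstep
  obtain ⟨N, hN⟩ := ω.2.2.1
  obtain ⟨M, hM⟩ := ω.2.2.2
  let t : ℕ → St (m + 1) R := fun j => Nat.rec 1 (fun i x => x * a (N + i)) j
  let s : ℤ → St (m + 1) R := fun k => t (k - N).toNat
  have hs0 : ∀ k ≤ N, s k = 1 := fun k hk => by
    simp only [s]
    rw [show (k - N).toNat = 0 by omega]
    rfl
  have hs1 : ∀ k, s (k + 1) = s k * a k := fun k => by
    rcases lt_or_ge k N with hk | hk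
    · rw [hs0 k hk.le, hs0 _ hk, ha1 k ((hN k hk.le).trans (hN _ hk).symm), mul_one]
    · simp only [s]
      rw [show (k + 1 - N).toNat = (k - N).toNat + 1 by omega]
      change t _ * a (N + ((k - N).toNat : ℤ)) = _
      rw [show N + ((k - N).toNat : ℤ) = k by omega]
  have hsω : ∀ k, ω.1 k = stAct (eBase m R) (s k) := by
    intro k
    rcases le_total k N with hk | hk
    · rw [hs0 k hk, stAct_one, hN k hk]
    · induction k, hk using Int.leInduction with
      | base => rw [hs0 N le_rfl, stAct_one, hN N le_rfl]
      | succ k hk ih => rw [hs1, stAct_mul, ← ih, hω]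
  have hsM : ∀ k ≥ M, s k = s M := by
    intro k hk
    induction k, hk using Int.leInduction with
    | base => rfl
    | succ k hk ih =>
      rw [hs1, ih, ha1 k ((hM k hk).trans (hM _ (by omega)).symm), mul_one]
  refine ⟨s M, s, ⟨isMorphism_line_iff.2 fun k => st_local_iff.2 ?_, ⟨N, hs0⟩, ⟨M, hsM⟩⟩,
    fun k => congrArg row (hsω k)⟩
  obtain ⟨α, h⟩ := ha k
  exact ⟨α, a k, h, (hs1 k).symm⟩

/-- The coset modulo `(P̃_n(R))₂` of the end point of a lift is invariant under stable homotopy. -/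
theorem LiftsTo.sameCoset_of_stablyHomotopic {ω ω' : (eumAction m R).Loop (eBase m R)}
    {x y : St (m + 1) R} (hx : LiftsTo m R ω x) (hy : LiftsTo m R ω' y)
    (h : (eumAction m R).StablyHomotopic _ ω ω') : SameCoset x y := by
  obtain ⟨H, hH, hrow, ⟨N, hN⟩, M, hM⟩ := h
  rw [isMorphism_plane_iff] at hH
  let η : ℤ → (eumAction m R).Loop (eBase m R) := fun l => ⟨fun k => H (k, l), hrow l⟩
  choose z hz using fun l => exists_liftsTo (η l)
  have hself : ∀ θ : (eumAction m R).Loop (eBase m R), ∀ k,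
      (eumAction m R).Local {θ.1 k, θ.1 (k + 1), θ.1 k, θ.1 (k + 1)} := fun θ k =>
    (θ.local k).mono (by simp)
  have hsucc : ∀ l, SameCoset (z l) (z (l + 1)) := fun l => by
    refine (hz l).sameCoset (hz (l + 1)) fun k => (hH k l).mono ?_
    rintro _ (rfl | rfl | rfl | rfl)
    · exact ⟨(k, l), ⟨Or.inl rfl, Or.inl rfl⟩, rfl⟩
    · exact ⟨(k + 1, l), ⟨Or.inr rfl, Or.inl rfl⟩, rfl⟩
    · exact ⟨(k, l + 1), ⟨Or.inl rfl, Or.inr rfl⟩, rfl⟩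
    · exact ⟨(k + 1, l + 1), ⟨Or.inr rfl, Or.inr rfl⟩, rfl⟩
  have hall : ∀ l ≥ N, SameCoset (z N) (z l) := fun l hl => by
    induction l, hl using Int.leInduction with
    | base => exact .refl _
    | succ l _ ih => exact ih.trans (hsucc l)
  have e1 : η N = ω := Subtype.ext (funext fun k => hN N le_rfl k)
  have e2 : η (max N M) = ω' := Subtype.ext (funext fun k => hM _ (le_max_right _ _) k)
  have h1 : SameCoset x (z N) := hx.sameCoset (e1 ▸ hz N) (hself ω)
  have h2 : SameCoset (z (max N M)) y := LiftsTo.sameCoset (e2 ▸ hz (max N M)) hy (hself ω')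
  exact h1.trans ((hall _ (le_max_left _ _)).trans h2)

variable (m R) in
/-- The coset of the end points of the lifts of a homotopy class of loops. -/
def liftCoset : Pi1EUm m R → Pt m R ⧸ (Pt2 m R).subgroupOf (Pt m R) :=
  Quot.lift (fun ω => QuotientGroup.mk ⟨(exists_liftsTo ω).choose,
    (exists_liftsTo ω).choose_spec.mem_Pt⟩) fun ω ω' h =>
    QuotientGroup.eq.2 (Subgroup.mem_subgroupOf.2
      (((exists_liftsTo ω).choose_spec.sameCoset_of_stablyHomotopic
        (exists_liftsTo ω').choose_spec h).of_mem_Pt (exists_liftsTo ω).choose_spec.mem_Pt))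

theorem liftCoset_mk {ω : (eumAction m R).Loop (eBase m R)} (x : Pt m R)
    (h : LiftsTo m R ω x) : liftCoset m R (Quot.mk _ ω) = QuotientGroup.mk x :=
  QuotientGroup.eq.2 (Subgroup.mem_subgroupOf.2
    (((exists_liftsTo ω).choose_spec.sameCoset h fun k =>
      (ω.local k).mono (by simp)).of_mem_Pt
        (exists_liftsTo ω).choose_spec.mem_Pt))

variable (m R) in
/-- The identification of the fundamental group of the elementary unimodular rows with
`P̃_n(R) / (P̃_n(R))₂`. -/
def pi1Equiv : Pt m R ⧸ (Pt2 m R).subgroupOf (Pt m R) ≃ Pi1EUm m R where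
  toFun := Quotient.lift (fun x => loopClass x.1) fun x y h => by
    have h : (x⁻¹ * y : St (m + 1) R) ∈ Pt2 m R :=
      Subgroup.mem_subgroupOf.1 (QuotientGroup.leftRel_apply.1 h)
    have h' : (y * x⁻¹ : St (m + 1) R) ∈ Pt2 m R := by
      simpa [mul_assoc] using conj_mem_Pt2 h (inv_mem x.2)
    have := loopClass_mul_of_mem_Pt2 (y := x.1) h'
    rw [InvMemClass.coe_inv, inv_mul_cancel_right] at this
    exact this.symm
  invFun := liftCoset m R
  left_inv q := by
    induction q using QuotientGroup.induction_on with
    | H x =>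
      obtain ⟨ω, hω⟩ := exists_loop_of_mem_Pt x.2
      change liftCoset m R (loopClass x.1) = _
      rw [loopClass_eq_of_liftsTo hω, liftCoset_mk x hω]
  right_inv z := by
    induction z using Quot.ind with
    | mk ω => exact loopClass_eq_of_liftsTo (exists_liftsTo ω).choose_spec

theorem pi1Equiv_mk {ω : (eumAction m R).Loop (eBase m R)} (x : Pt m R) (h : LiftsTo m R ω x) :
    pi1Equiv m R (QuotientGroup.mk x) = Quot.mk _ ω :=
  loopClass_eq_of_liftsTo h

theorem pi1Equiv_one : pi1Equiv m R (QuotientGroup.mk 1) = pi1Base m R := by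
  obtain ⟨α⟩ := (inferInstance : Nonempty (NilIndex (m + 1)))
  refine pi1Equiv_mk 1 ⟨fun _ => 1, ⟨isMorphism_line_iff.2 fun k => st_local_iff.2
    ⟨α, 1, one_mem _, mul_one _⟩, ⟨0, fun _ _ => rfl⟩, ⟨0, fun _ _ => rfl⟩⟩, fun k => ?_⟩
  rw [map_one, Um.act_one]
  rfl

end Lifting

/-! ### The stabilizer of `e` and the quotients of `K₁` -/

section Stabilizer

variable {m : ℕ} {R : Type u} [Ring R]

theorem mem_P_iff {σ : GL (Fin (m + 1)) R} :
    σ ∈ P m R ↔ ∀ j, σ.1 0 j = (Pi.single 0 1 : Fin (m + 1) → R) j := by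
  have h : ((e m R).act σ).1 = σ.1 0 := single_one_vecMul (0 : Fin (m + 1)) σ.1
  constructor
  · intro hσ j
    rw [← h]
    exact congrFun (congrArg Subtype.val (show (e m R).act σ = e m R from hσ)) j
  · intro hσ
    exact Subtype.ext (h.trans (funext hσ))

theorem stab_mem_P (τ : GL (Fin m) R) : stab m R τ ∈ P m R :=
  mem_P_iff.2 fun j => by refine Fin.cases ?_ (fun j => ?_) j <;> simp [stab]

theorem rd_mul (σ τ : P m R) : rd (σ * τ) = rd σ * rd τ := by
  apply Units.ext
  ext i j
  have h := mem_P_iff.1 τ.2 j.succ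
  simp only [Pi.single_apply, Fin.succ_ne_zero, if_false] at h
  simp [rd, mul_apply, Fin.sum_univ_succ, h]

variable (m R) in
/-- The lower right block of a matrix in `P_n(R)`, as a homomorphism. -/
def rdHom : P m R →* GL (Fin m) R :=
  MonoidHom.mk' rd rd_mul

theorem rd_stab (τ : GL (Fin m) R) : rd ⟨stab m R τ, stab_mem_P τ⟩ = τ := by
  apply Units.ext
  ext i j
  simp [rd, stab]

variable (m) in
/-- The nilpotent set of the positions `(i, 0)`, `i ≠ 0`. -/
def firstColumn : NilIndex (m + 1) where
  carrier := {p | p.1 ≠ 0 ∧ p.2 = 0}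
  off_diag _ _ h hij := h.1 (hij.trans h.2)
  asymm _ _ h h' := h'.1 h.2
  trans _ _ _ h h' := ⟨h.1, h'.2⟩

/-- A matrix in `P_n(R)` agrees with its lower right block up to a matrix which differs from the
identity only in the first column. -/
theorem stab_rd_inv_mul_mem (σ : P m R) :
    (stab m R (rd σ))⁻¹ * σ.1 ∈ unip R (firstColumn m) := by
  have h0 := mem_P_iff.1 σ.2
  -- Outside of the first column, the matrix agrees with the identity.
  have key : ∀ i j, ((stab m R (rd σ)⁻¹) * σ.1).1 i j =
      if j = 0 ∧ i ≠ 0 then ((stab m R (rd σ)⁻¹) * σ.1).1 i j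
      else (1 : Matrix (Fin (m + 1)) (Fin (m + 1)) R) i j := by
    intro i j
    split_ifs with hij
    · rfl
    refine Fin.cases (fun hij => ?_) (fun i hij => ?_) i hij
    · simp [stab, mul_apply, Fin.sum_univ_succ, h0, one_apply, Pi.single_apply, eq_comm]
    · refine Fin.cases (fun hij => ?_) (fun j hij => ?_) j hij
      · exact absurd ⟨rfl, Fin.succ_ne_zero i⟩ hij
      · have h1 := congrFun (congrFun
          (congrArg (fun τ : GL (Fin m) R => τ.1) (inv_mul_cancel (rd σ))) i) j
        have h2 : (((rd σ)⁻¹ * rd σ : GL (Fin m) R).1 : Matrix _ _ R) i j =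
            ∑ k, ((rd σ)⁻¹).1 i k * σ.1.1 k.succ j.succ := by
          rw [Units.val_mul, mul_apply]
          rfl
        rw [h2] at h1
        simp [stab, mul_apply, Fin.sum_univ_succ, h1, one_apply]
  rw [← map_inv]
  refine ⟨fun i => ?_, fun i j hij hα => ?_⟩
  · rw [key, if_neg (fun h => h.2 h.1), one_apply_eq]
  · rw [key, if_neg (fun h => hα ⟨h.2, h.1⟩), one_apply_ne hij]

theorem EP2_le_EP : EP2 m R ≤ EP m R := (Subgroup.closure_le _).2 fun _ h => h.1

theorem EP2_le_E : EP2 m R ≤ E (m + 1) R := EP2_le_EP.trans inf_le_right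

theorem mem_EP2_of_mem_unip {α : NilIndex (m + 1)} {g : GL (Fin (m + 1)) R} (hP : g ∈ P m R)
    (hg : g ∈ unip R α) : g ∈ EP2 m R :=
  Subgroup.subset_closure ⟨⟨hP, unip_le_E α hg⟩, 1, one_mem _, α, α, g, hg, 1, one_mem _, by simp⟩

theorem stab_rd_inv_mul_mem_EP2 (σ : P m R) : (stab m R (rd σ))⁻¹ * σ.1 ∈ EP2 m R :=
  mem_EP2_of_mem_unip (mul_mem (inv_mem (stab_mem_P _)) σ.2) (stab_rd_inv_mul_mem σ)

theorem stab_rd_mem_EP2_iff (σ : P m R) : stab m R (rd σ) ∈ EP2 m R ↔ σ.1 ∈ EP2 m R := by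
  have h := stab_rd_inv_mul_mem_EP2 σ
  constructor
  · intro h'
    simpa using mul_mem h' h
  · intro h'
    simpa using mul_mem h' (inv_mem h)

theorem elem_mem_unip {n : ℕ} (p : OffDiag n) (r : R) : elem p r ∈ unip R (.single p) := by
  rw [← θ_of]
  exact θ_mem_unip (of_mem_stUnip (show p.1 ∈ (NilIndex.single p).carrier from Or.inl rfl) r)

theorem stab_elem (p : OffDiag m) (r : R) :
    stab m R (elem p r) =
      elem ⟨(p.1.1.succ, p.1.2.succ), fun h => p.2 (Fin.succ_injective _ h)⟩ r := by
  apply Units.ext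
  ext i j
  refine Fin.cases ?_ (fun i => ?_) i <;> refine Fin.cases ?_ (fun j => ?_) j <;>
    simp [stab, elem, one_apply, single_apply, Fin.succ_ne_zero, (Fin.succ_ne_zero _).symm]

theorem stab_mem_EP2 {τ : GL (Fin m) R} (hτ : τ ∈ E m R) : stab m R τ ∈ EP2 m R := by
  have : E m R ≤ (EP2 m R).comap (stab m R) := by
    refine (Subgroup.closure_le _).2 ?_
    rintro _ ⟨p, r, rfl⟩
    have h := stab_elem p r
    exact mem_EP2_of_mem_unip (stab_mem_P _) (h ▸ elem_mem_unip _ r)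
  exact this hτ

theorem map_Pt2 : (Pt2 m R).map (θ (m + 1) R) = EP2 m R := by
  rw [Pt2, MonoidHom.map_closure, EP2]
  congr 1
  ext g
  constructor
  · rintro ⟨_, ⟨hP, x, α, β, a, ha, b, hb, rfl⟩, rfl⟩
    exact ⟨hP, _, θ_mem_E x, α, β, _, θ_mem_unip ha, _, θ_mem_unip hb, by simp⟩
  · rintro ⟨hP, x, hx, α, β, a, ha, b, hb, rfl⟩
    obtain ⟨x, rfl⟩ := exists_θ_eq hx
    obtain ⟨a, ha', rfl⟩ := exists_mem_stUnip ha
    obtain ⟨b, hb', rfl⟩ := exists_mem_stUnip hb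
    have e : θ (m + 1) R (x⁻¹ * a * b * x) =
      (θ (m + 1) R x)⁻¹ * θ (m + 1) R a * θ (m + 1) R b * θ (m + 1) R x := by simp
    exact ⟨_, ⟨show θ (m + 1) R _ ∈ EP m R from e ▸ hP, x, α, β, a, ha', b, hb', rfl⟩, e⟩

theorem K1.mk_eq_iff {n : ℕ} {σ τ : GL (Fin n) R} : K1.mk σ = K1.mk τ ↔ σ⁻¹ * τ ∈ E n R :=
  QuotientGroup.eq

theorem K1.ind {n : ℕ} {q : K1 n R → Prop} (h : ∀ σ, q (K1.mk σ)) (x : K1 n R) : q x :=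
  QuotientGroup.induction_on x h

theorem mk_mem_K12_iff {τ : GL (Fin m) R} : K1.mk τ ∈ K12 m R ↔ stab m R τ ∈ EP2 m R := by
  constructor
  · rintro ⟨ρ, hρ, h⟩
    have := mul_mem (show stab m R ρ ∈ EP2 m R from hρ) (stab_mem_EP2 (K1.mk_eq_iff.1 h))
    rwa [← map_mul, mul_inv_cancel_left] at this
  · intro h
    exact ⟨τ, h, rfl⟩

variable (m R) in
/-- The map `[τ] ↦ diag(1, τ) (EP_n(R))₂`. It is injective, and hence controls the quotient of
`K_{1,n-1}(R)`. -/
def stabCoset : K1Quot m R → GL (Fin (m + 1)) R ⧸ EP2 m R :=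
  Quot.lift (Quotient.lift (fun τ => QuotientGroup.mk (stab m R τ)) fun σ τ h => by
    refine QuotientGroup.eq.2 ?_
    rw [← map_inv, ← map_mul]
    exact stab_mem_EP2 (QuotientGroup.leftRel_apply.1 h)) fun x y h => by
    obtain ⟨σ, τ, rfl, rfl, h⟩ := h
    refine QuotientGroup.eq.2 ?_
    rw [← map_inv, ← map_mul]
    exact mk_mem_K12_iff.1 h

theorem K1Quot.mk_eq_iff {σ τ : GL (Fin m) R} :
    K1Quot.mk (K1.mk σ) = K1Quot.mk (K1.mk τ) ↔ stab m R (σ⁻¹ * τ) ∈ EP2 m R := by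
  constructor
  · intro h
    have := QuotientGroup.eq.1 (congrArg (stabCoset m R) h)
    rwa [← map_inv, ← map_mul] at this
  · intro h
    exact Quot.sound ⟨σ, τ, rfl, rfl, mk_mem_K12_iff.2 h⟩

theorem K1Quot.ind {q : K1Quot m R → Prop} (h : ∀ τ, q (K1Quot.mk (K1.mk τ))) (x : K1Quot m R) :
    q x :=
  Quot.ind (fun y => K1.ind (q := fun y => q (K1Quot.mk y)) h y) x

variable (m R) in
/-- The map `[τ] ↦ [diag(1, τ)]`. -/
def stabClass (x : K1Quot m R) : K1 (m + 1) R :=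
  Subgroup.quotientMapOfLE EP2_le_E (stabCoset m R x)

theorem stabClass_mk (τ : GL (Fin m) R) :
    stabClass m R (K1Quot.mk (K1.mk τ)) = K1.mk (stab m R τ) := rfl

variable (m R) in
/-- The class in the quotient of `K_{1,n-1}(R)` of the lower right block of `θ(x)`. -/
def blockClass : Pt m R ⧸ (Pt2 m R).subgroupOf (Pt m R) → K1Quot m R :=
  Quotient.lift (fun x => K1Quot.mk (K1.mk (rd ⟨θ (m + 1) R x, x.2.1⟩))) fun x y h => by
    have h : (x⁻¹ * y : St (m + 1) R) ∈ Pt2 m R :=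
      Subgroup.mem_subgroupOf.1 (QuotientGroup.leftRel_apply.1 h)
    refine K1Quot.mk_eq_iff.2 ?_
    change stab m R ((rdHom m R _)⁻¹ * rdHom m R _) ∈ _
    rw [← map_inv, ← map_mul]
    refine (stab_rd_mem_EP2_iff _).2 ?_
    have := Subgroup.mem_map_of_mem (θ (m + 1) R) h
    rw [map_Pt2, map_mul] at this
    simpa using this

end Stabilizer

/-! ### Path components of the unimodular rows -/

namespace GlobalAction

theorem pathConnected_of_local {A : GlobalAction.{u, v, w}} {x y : A.X} (h : A.Local {x, y}) :
    A.PathConnected x y :=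
  let p := (Cover.constPath (h.mono (by simp)) 0).append y h
  ⟨p.toFun, isMorphism_line_iff.2 p.loc, p.left, p.T,
    fun k hk => (p.right k hk).trans (BasedPath.append_last _ _ _)⟩

end GlobalAction

section Components

variable {m : ℕ} {R : Type u} [Ring R]

open GlobalAction

theorem um_local_iff {n : ℕ} {v w : Um R n} : (umAction R n).Local ({v, w} : Set (Um R n)) ↔
    ∃ α : NilIndex n, ∃ g ∈ unip R α, v.act g = w := by
  constructor
  · rintro ⟨α, hα⟩
    obtain ⟨_, ⟨g, hg⟩, h⟩ := hα v (Or.inl rfl) w (Or.inr rfl)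
    exact ⟨α, g, hg, h⟩
  · rintro ⟨α, g, hg, rfl⟩
    refine local_of_orb (a := α) (x := v) ?_
    rintro y (rfl | rfl)
    · exact Orb.refl trivial
    · exact ⟨trivial, ⟨g, hg⟩, rfl⟩

/-- The points of a path of unimodular rows lie in one orbit of the elementary group. -/
theorem exists_act_eq_of_pathConnected {n : ℕ} {v w : Um R n}
    (h : (umAction R n).PathConnected v w) : ∃ ε ∈ E n R, v.act ε = w := by
  obtain ⟨ω, hω, ⟨N, hN⟩, M, hM⟩ := h
  have key : ∀ k ≥ N, ∃ ε ∈ E n R, v.act ε = ω k := fun k hk => by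
    induction k, hk using Int.leInduction with
    | base => exact ⟨1, one_mem _, by rw [Um.act_one, hN N le_rfl]⟩
    | succ k hk ih =>
      obtain ⟨ε, hε, h⟩ := ih
      obtain ⟨α, g, hg, h'⟩ := um_local_iff.1 (isMorphism_line_iff.1 hω k)
      exact ⟨ε * g, mul_mem hε (unip_le_E α hg), by rw [Um.act_mul, h, h']⟩
  have := key (max N M) (le_max_left _ _)
  rwa [hM _ (le_max_right _ _)] at this

theorem Pi0Um.mk_act (v : Um R (m + 1)) {ε : GL (Fin (m + 1)) R} (hε : ε ∈ E (m + 1) R) :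
    Pi0Um.mk (v.act ε) = Pi0Um.mk v := by
  unfold E at hε
  induction hε using Subgroup.closure_induction generalizing v with
  | mem g hg =>
    obtain ⟨p, r, rfl⟩ := hg
    exact (Quot.sound (pathConnected_of_local
      (um_local_iff.2 ⟨.single p, _, elem_mem_unip p r, rfl⟩))).symm
  | one => rw [Um.act_one]
  | mul x y _ _ hx hy => rw [Um.act_mul, hy, hx]
  | inv x _ hx => rw [← hx, ← Um.act_mul, inv_mul_cancel, Um.act_one]

theorem Pi0Um.mk_eq_iff {v w : Um R (m + 1)} :
    Pi0Um.mk v = Pi0Um.mk w ↔ ∃ ε ∈ E (m + 1) R, v.act ε = w := by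
  constructor
  · intro h
    have h' : Relation.EqvGen (umAction R (m + 1)).PathConnected v w := Quot.eqvGen_exact h
    clear h
    induction h' with
    | rel v w h => exact exists_act_eq_of_pathConnected h
    | refl v => exact ⟨1, one_mem _, Um.act_one _⟩
    | symm v w _ ih =>
      obtain ⟨ε, hε, rfl⟩ := ih
      exact ⟨ε⁻¹, inv_mem hε, by rw [← Um.act_mul, mul_inv_cancel, Um.act_one]⟩
    | trans v w z _ _ ih ih' =>
      obtain ⟨ε, hε, rfl⟩ := ih
      obtain ⟨ε', hε', rfl⟩ := ih'
      exact ⟨ε * ε', mul_mem hε hε', Um.act_mul _ _ _⟩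
  · rintro ⟨ε, hε, rfl⟩
    exact (Pi0Um.mk_act v hε).symm

theorem Pi0Um.ind {q : Pi0Um m R → Prop} (h : ∀ v, q (Pi0Um.mk v)) (x : Pi0Um m R) : q x :=
  Quot.ind h x

variable (m R) in
/-- The map `[σ] ↦ [e σ]`. -/
def firstRowClass : K1 (m + 1) R → Pi0Um m R :=
  Quotient.lift (fun σ => Pi0Um.mk ((e m R).act σ)) fun σ τ h =>
    Pi0Um.mk_eq_iff.2 ⟨σ⁻¹ * τ, QuotientGroup.leftRel_apply.1 h, by
      rw [← Um.act_mul, mul_inv_cancel_left]⟩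

end Components

/-! ### Stably free modules and kernels of unimodular rows -/

section Modules

variable {m n : ℕ} {R : Type u} [Ring R]

theorem K0s.mk_eq_iff {k : ℕ} {M N : Type u} [AddCommGroup M] [Module Rᵐᵒᵖ M] [AddCommGroup N]
    [Module Rᵐᵒᵖ N] {hM : IsStablyFree R k M} {hN : IsStablyFree R k N} :
    K0s.mk k M hM = K0s.mk k N hN ↔ Nonempty (M ≃ₗ[Rᵐᵒᵖ] N) :=
  Quotient.eq

theorem rowMap_apply (v : Um R n) (x : Fin n → R) : rowMap v x = v.1 ⬝ᵥ x := rfl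

/-- An invertible matrix, acting on columns from the left, as a right linear automorphism. -/
def columnEquiv (σ : GL (Fin n) R) : (Fin n → R) ≃ₗ[Rᵐᵒᵖ] (Fin n → R) where
  toFun x := σ.1 *ᵥ x
  invFun x := (σ⁻¹).1 *ᵥ x
  map_add' := mulVec_add _
  map_smul' r x := mulVec_smul _ r x
  left_inv x := by simp [mulVec_mulVec]
  right_inv x := by simp [mulVec_mulVec]

/-- An automorphism which transforms one row into another restricts to their kernels. -/
def kerEquiv {v w : Um R n} (f : (Fin n → R) ≃ₗ[Rᵐᵒᵖ] (Fin n → R))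
    (h : ∀ x, rowMap w (f x) = rowMap v x) :
    LinearMap.ker (rowMap v) ≃ₗ[Rᵐᵒᵖ] LinearMap.ker (rowMap w) :=
  LinearEquiv.ofSubmodules f _ _ <| by
    ext x
    constructor
    · rintro ⟨y, hy, rfl⟩
      exact (h y).trans hy
    · intro hx
      exact ⟨f.symm x, by simpa [← h] using hx, f.apply_symm_apply x⟩

theorem rowMap_act (v : Um R n) (σ : GL (Fin n) R) (x : Fin n → R) :
    rowMap v (columnEquiv σ x) = rowMap (v.act σ) x :=
  dotProduct_mulVec v.1 σ.1 x

/-- A right linear form on columns is given by a row. -/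
theorem linear_eq_dotProduct (f : (Fin n → R) →ₗ[Rᵐᵒᵖ] R) (x : Fin n → R) :
    f x = (fun i => f (Pi.single i 1)) ⬝ᵥ x := by
  conv_lhs => rw [← Finset.univ_sum_single x]
  rw [map_sum, dotProduct]
  refine Finset.sum_congr rfl fun i _ => ?_
  have : (Pi.single i (x i) : Fin n → R) = MulOpposite.op (x i) • Pi.single i 1 := by
    rw [← Pi.single_smul]
    simp
  rw [this, map_smul]
  rfl

theorem exists_mulVec_eq (f : (Fin n → R) →ₗ[Rᵐᵒᵖ] (Fin n → R)) :
    ∃ M : Matrix (Fin n) (Fin n) R, ∀ x, f x = M *ᵥ x :=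
  ⟨of fun i j => f (Pi.single j 1) i, fun x => funext fun i =>
    linear_eq_dotProduct (LinearMap.proj i ∘ₗ f) x⟩

theorem exists_columnEquiv_eq (f : (Fin n → R) ≃ₗ[Rᵐᵒᵖ] (Fin n → R)) :
    ∃ σ : GL (Fin n) R, f = columnEquiv σ := by
  obtain ⟨M, hM⟩ := exists_mulVec_eq f.toLinearMap
  obtain ⟨N, hN⟩ := exists_mulVec_eq f.symm.toLinearMap
  have hext : ∀ A : Matrix (Fin n) (Fin n) R, (∀ x, A *ᵥ x = x) → A = 1 := fun A hA =>
    ext_of_mulVec_single fun i => by rw [hA, one_mulVec]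
  refine ⟨⟨M, N, hext _ fun x => ?_, hext _ fun x => ?_⟩, LinearEquiv.ext hM⟩
  · rw [← mulVec_mulVec, ← hN, ← hM]
    exact f.apply_symm_apply x
  · rw [← mulVec_mulVec, ← hM, ← hN]
    exact f.symm_apply_apply x

/-- A unimodular row splits: `ker β_v ⊕ R ≅ R^n`. -/
theorem exists_splitting (v : Um R n) :
    ∃ f : (LinearMap.ker (rowMap v) × R) ≃ₗ[Rᵐᵒᵖ] (Fin n → R), ∀ p, rowMap v (f p) = p.2 := by
  obtain ⟨w, hw⟩ := v.2
  have hv : ∀ r : R, rowMap v (fun i => w i * r) = r := by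
    intro r
    change ∑ i, v.1 i * (w i * r) = r
    simp only [← mul_assoc, ← Finset.sum_mul]
    have : ∑ i, v.1 i * w i = 1 := hw
    rw [this, one_mul]
  have hf : ∀ p : LinearMap.ker (rowMap v) × R,
      rowMap v (p.1.1 + fun i => w i * p.2) = p.2 := fun p => by
    rw [map_add, hv, LinearMap.mem_ker.1 p.1.2, zero_add]
  refine ⟨⟨⟨⟨fun p => p.1.1 + fun i => w i * p.2, fun p q => ?_⟩, fun r p => ?_⟩,
    fun x => (⟨x - fun i => w i * rowMap v x, ?_⟩, rowMap v x), fun p => ?_, fun x => ?_⟩, hf⟩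
  · ext i
    simp [mul_add]
    abel
  · ext i
    simp [mul_assoc]
  · rw [LinearMap.mem_ker, map_sub, hv, sub_self]
  · refine Prod.ext (Subtype.ext ?_) (hf p)
    change (p.1.1 + fun i => w i * p.2) - (fun i => w i * rowMap v _) = p.1.1
    rw [hf, add_sub_cancel_right]
  · exact sub_add_cancel x _

/-- Unimodular rows with isomorphic kernels lie in one orbit of the general linear group. -/
theorem nonempty_ker_equiv_iff {v w : Um R n} :
    Nonempty (LinearMap.ker (rowMap v) ≃ₗ[Rᵐᵒᵖ] LinearMap.ker (rowMap w)) ↔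
      ∃ σ, v.act σ = w := by
  constructor
  · rintro ⟨g⟩
    obtain ⟨f, hf⟩ := exists_splitting v
    obtain ⟨f', hf'⟩ := exists_splitting w
    obtain ⟨σ, hσ⟩ := exists_columnEquiv_eq
      ((f'.symm.trans (g.symm.prodCongr (LinearEquiv.refl Rᵐᵒᵖ R))).trans f)
    have key : ∀ x, (v.act σ).1 ⬝ᵥ x = w.1 ⬝ᵥ x := fun x => by
      rw [← rowMap_apply, ← rowMap_act, ← hσ]
      change rowMap v (f _) = rowMap w x
      rw [hf]
      conv_rhs => rw [← f'.apply_symm_apply x, hf']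
      rfl
    refine ⟨σ, Subtype.ext (funext fun i => ?_)⟩
    simpa using key (Pi.single i 1)
  · rintro ⟨σ, rfl⟩
    exact ⟨(kerEquiv (columnEquiv σ) (rowMap_act v σ)).symm⟩

theorem nonempty_ker_e_equiv :
    Nonempty (LinearMap.ker (rowMap (e m R)) ≃ₗ[Rᵐᵒᵖ] (Fin m → R)) := by
  have h0 : ∀ x : Fin (m + 1) → R, rowMap (e m R) x = x 0 := fun x => by
    rw [rowMap_apply]
    simp [e]
  exact ⟨{
    toFun := fun x => Fin.tail x.1
    map_add' := fun _ _ => rfl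
    map_smul' := fun _ _ => rfl
    invFun := fun y => ⟨Fin.cons 0 y, by rw [LinearMap.mem_ker, h0, Fin.cons_zero]⟩
    left_inv := fun x => Subtype.ext <| by
      have h : x.1 0 = 0 := (h0 x.1).symm.trans (LinearMap.mem_ker.1 x.2)
      change Fin.cons 0 (Fin.tail x.1) = x.1
      rw [← h, Fin.cons_self_tail]
    right_inv := fun y => Fin.tail_cons _ _ }⟩

/-- A complement of `R` in `R^n` is the kernel of a unimodular row. -/
theorem exists_ker_equiv {M : Type u} [AddCommGroup M] [Module Rᵐᵒᵖ M]
    (g : (M × R) ≃ₗ[Rᵐᵒᵖ] (Fin n → R)) :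
    ∃ v : Um R n, Nonempty (LinearMap.ker (rowMap v) ≃ₗ[Rᵐᵒᵖ] M) := by
  let f : (Fin n → R) →ₗ[Rᵐᵒᵖ] R := LinearMap.snd Rᵐᵒᵖ M R ∘ₗ g.symm.toLinearMap
  have hf : ∀ p, f (g p) = p.2 := fun p => congrArg Prod.snd (g.symm_apply_apply p)
  let v : Um R n := ⟨fun i => f (Pi.single i 1), g (0, 1), by rw [← linear_eq_dotProduct, hf]⟩
  have hv : ∀ x, rowMap v x = f x := fun x => (linear_eq_dotProduct f x).symm
  refine ⟨v, ⟨LinearEquiv.symm {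
    toFun := fun y => ⟨g (y, 0), by rw [LinearMap.mem_ker, hv, hf]⟩
    map_add' := fun x y => Subtype.ext <| by
      change g (x + y, 0) = g (x, 0) + g (y, 0)
      rw [← map_add, Prod.mk_add_mk, add_zero]
    map_smul' := fun r x => Subtype.ext <| by
      change g (r • x, 0) = r • g (x, 0)
      rw [← map_smul, Prod.smul_mk, smul_zero]
    invFun := fun x => (g.symm x.1).1
    left_inv := fun y => by simp
    right_inv := fun x => Subtype.ext <| by
      have h : (g.symm x.1).2 = 0 := (hv x.1).symm.trans (LinearMap.mem_ker.1 x.2)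
      change g ((g.symm x.1).1, 0) = x.1
      rw [← h, Prod.mk.eta, g.apply_symm_apply] }⟩⟩

variable (m R) in
/-- The map `[v] ↦ [ker β_v]`. -/
def kerClass : Pi0Um m R → K0s R m :=
  Quot.lift (fun v : Um R (m + 1) => K0s.mk m _ (isStablyFree_ker v)) fun v w h => by
    obtain ⟨ε, -, h⟩ := exists_act_eq_of_pathConnected h
    exact K0s.mk_eq_iff.2 (nonempty_ker_equiv_iff.2 ⟨ε, h⟩)

variable (m R) in
/-- The map `[M] ↦ [M ⊕ R]`. -/
def addFree : K0s R m → K0s R (m + 1) :=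
  Quotient.lift (fun M => K0s.mk (m + 1) (M.1 × R) M.2.prod_ring) fun _ _ h =>
    K0s.mk_eq_iff.2 (h.map fun f => f.prodCongr (.refl _ _))

theorem kerClass_e : kerClass m R (Pi0Um.mk (e m R)) = k0Base R m :=
  K0s.mk_eq_iff.2 nonempty_ker_e_equiv

end Modules

end UmGA

end

theorem proposition5p2 (R : Type*) [Ring R] (m : ℕ) (hm : 2 ≤ m) :
    ∃ (Ψ : Pt m R ⧸ (Pt2 m R).subgroupOf (Pt m R) ≃ Pi1EUm m R)
      (η : K2 (m + 1) R → Pi1EUm m R)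
      (μ : Pi1EUm m R → K1Quot m R)
      (lam : K1Quot m R → K1 (m + 1) R)
      (α : K1 (m + 1) R → Pi0Um m R)
      (β : Pi0Um m R → K0s R m)
      (γ : K0s R m → K0s R (m + 1)),
      -- the identification of `π₁(EUm_n(R))`, where `n = m + 1`, by lifting loops
      (∀ Y : Pt m R, ∃ ω, LiftsTo m R ω Y) ∧
      (∀ (Y : Pt m R) (ω : (eumAction m R).Loop (eBase m R)), LiftsTo m R ω Y →
        Ψ (QuotientGroup.mk Y) = Quot.mk _ ω) ∧
      -- the maps (the first one, `δ`, is the inclusion)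
      (∀ Y : K2 (m + 1) R,
        η Y = Ψ (QuotientGroup.mk (Subgroup.inclusion (K2_le_Pt m R) Y))) ∧
      (∀ Y : Pt m R,
        μ (Ψ (QuotientGroup.mk Y)) = K1Quot.mk (K1.mk (rd ⟨θ (m + 1) R Y, Y.2.1⟩))) ∧
      (∀ τ : GL (Fin m) R, lam (K1Quot.mk (K1.mk τ)) = K1.mk (stab m R τ)) ∧
      (∀ σ : GL (Fin (m + 1)) R, α (K1.mk σ) = Pi0Um.mk ((e m R).act σ)) ∧
      (∀ v : Um R (m + 1), β (Pi0Um.mk v) = K0s.mk m _ (isStablyFree_ker v)) ∧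
      (∀ (M : Type _) [AddCommGroup M] [Module Rᵐᵒᵖ M] (h : IsStablyFree R m M),
        γ (K0s.mk m M h) = K0s.mk (m + 1) (M × R) h.prod_ring) ∧
      -- they preserve the base points
      η 1 = pi1Base m R ∧ μ (pi1Base m R) = K1Quot.mk (K1.mk 1) ∧
      lam (K1Quot.mk (K1.mk 1)) = K1.mk 1 ∧ α (K1.mk 1) = Pi0Um.mk (e m R) ∧
      β (Pi0Um.mk (e m R)) = k0Base R m ∧ γ (k0Base R m) = k0Base R (m + 1) ∧
      -- exactness at the six inner terms
      ExactAt (Subgroup.inclusion (inf_le_left : K22 m R ≤ K2 (m + 1) R)) η (pi1Base m R) ∧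
      ExactAt η μ (K1Quot.mk (K1.mk 1)) ∧
      ExactAt μ lam (K1.mk 1) ∧
      ExactAt lam α (Pi0Um.mk (e m R)) ∧
      ExactAt α β (k0Base R m) ∧
      ExactAt β γ (k0Base R (m + 1)) := by
  have heq : ∀ Y : Pt m R, pi1Equiv m R (QuotientGroup.mk Y) = pi1Base m R ↔
      (Y : St (m + 1) R) ∈ Pt2 m R := fun Y => by
    rw [← pi1Equiv_one, (pi1Equiv m R).apply_eq_iff_eq, eq_comm, QuotientGroup.eq,
      Subgroup.mem_subgroupOf, inv_one, one_mul]
  have hμ : ∀ Y : Pt m R, blockClass m R ((pi1Equiv m R).symm (pi1Equiv m R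
      (QuotientGroup.mk Y))) = K1Quot.mk (K1.mk (rd ⟨θ (m + 1) R Y, Y.2.1⟩)) := fun Y => by
    rw [Equiv.symm_apply_apply]
    rfl
  have hpi1 : ∀ z : Pi1EUm m R, ∃ Y : Pt m R, pi1Equiv m R (QuotientGroup.mk Y) = z := fun z => by
    obtain ⟨q, rfl⟩ := (pi1Equiv m R).surjective z
    obtain ⟨Y, rfl⟩ := QuotientGroup.mk_surjective q
    exact ⟨Y, rfl⟩
  have hrd1 : rd (1 : P m R) = 1 := map_one (rdHom m R)
  have hμ1 : blockClass m R ((pi1Equiv m R).symm (pi1Base m R)) = K1Quot.mk (K1.mk 1) := by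
    rw [← pi1Equiv_one, hμ, ← hrd1]
    congr 3
  have hγ1 : addFree m R (k0Base R m) = k0Base R (m + 1) :=
    K0s.mk_eq_iff.2 ⟨(LinearEquiv.prodComm _ _ _).trans (Fin.consLinearEquiv Rᵐᵒᵖ fun _ => R)⟩
  refine ⟨pi1Equiv m R,
    fun Y => pi1Equiv m R (QuotientGroup.mk (Subgroup.inclusion (K2_le_Pt m R) Y)),
    fun z => blockClass m R ((pi1Equiv m R).symm z),
    stabClass m R, firstRowClass m R, kerClass m R, addFree m R,
    fun Y => exists_loop_of_mem_Pt Y.2, fun Y ω h => pi1Equiv_mk Y h, fun _ => rfl, hμ,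
    stabClass_mk, fun _ => rfl, fun _ => rfl, fun _ _ _ _ => rfl,
    (heq 1).2 (one_mem _), hμ1, (stabClass_mk 1).trans (by rw [map_one]),
    congrArg Pi0Um.mk (Um.act_one _), kerClass_e, hγ1, ?_, ?_, ?_, ?_, ?_, ?_⟩
  -- `η(Y)` is trivial if and only if `Y ∈ (P̃_n(R))₂`, by the injectivity of `Ψ`.
  · intro Y
    refine (heq _).trans ⟨fun h => ⟨⟨Y, Y.2, h⟩, rfl⟩, ?_⟩
    rintro ⟨Z, rfl⟩
    exact Z.2.2
  -- The block of `θ(Y)` is trivial if and only if `θ(Y) ∈ (EP_n(R))₂ = θ((P̃_n(R))₂)`, i.e. if `Y`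
  -- is the product of an element of `ker θ` and one of `(P̃_n(R))₂`.
  · intro z
    obtain ⟨Y, rfl⟩ := hpi1 z
    beta_reduce
    rw [hμ, eq_comm, K1Quot.mk_eq_iff, inv_one, one_mul, stab_rd_mem_EP2_iff, ← map_Pt2]
    constructor
    · rintro ⟨Z, hZ, h⟩
      have hK : (Y : St (m + 1) R) * Z⁻¹ ∈ K2 (m + 1) R := by
        change θ (m + 1) R _ = 1
        rw [map_mul, map_inv, h, mul_inv_cancel]
      refine ⟨⟨_, hK⟩, congrArg _ (QuotientGroup.eq.2 (Subgroup.mem_subgroupOf.2 ?_))⟩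
      simpa using hZ
    · rintro ⟨Z, hZ⟩
      have h := Subgroup.mem_subgroupOf.1 (QuotientGroup.eq.1 ((pi1Equiv m R).injective hZ))
      refine ⟨_, h, ?_⟩
      have hθ : θ (m + 1) R Z = 1 := Z.2
      simp [hθ]
  -- `diag(1, τ)` is elementary if and only if it lifts to an element of `P̃_n(R)`.
  · intro x
    induction x using K1Quot.ind with
    | h τ =>
    rw [stabClass_mk, eq_comm, K1.mk_eq_iff, inv_one, one_mul]
    constructor
    · intro hτ
      obtain ⟨Y, hY⟩ := exists_θ_eq hτ
      have hP : θ (m + 1) R Y ∈ EP m R := hY ▸ ⟨stab_mem_P τ, hτ⟩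
      refine ⟨pi1Equiv m R (QuotientGroup.mk ⟨Y, hP⟩), (hμ _).trans ?_⟩
      conv_rhs => rw [← rd_stab τ]
      congr 3
      exact Subtype.ext hY
    · rintro ⟨z, hz⟩
      obtain ⟨Y, rfl⟩ := hpi1 z
      beta_reduce at hz
      rw [hμ, K1Quot.mk_eq_iff, map_mul, map_inv] at hz
      have h := mul_mem (stab_rd_inv_mul_mem_EP2 ⟨θ (m + 1) R Y, Y.2.1⟩ |> inv_mem) hz
      have h' := mul_mem (θ_mem_E (Y : St (m + 1) R)) (EP2_le_E h)
      simpa using h'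
  -- If `e σ ε = e` with `ε` elementary, then `σ ε` is `diag(1, τ)` up to an elementary factor.
  · intro x
    induction x using K1.ind with
    | h σ =>
    change Pi0Um.mk ((e m R).act σ) = _ ↔ _
    constructor
    · intro h
      obtain ⟨ε, hε, h⟩ := Pi0Um.mk_eq_iff.1 h
      have hP : σ * ε ∈ P m R := by
        change (e m R).act (σ * ε) = e m R
        rw [Um.act_mul, h]
      refine ⟨K1Quot.mk (K1.mk (rd ⟨σ * ε, hP⟩)), (stabClass_mk _).trans (K1.mk_eq_iff.2 ?_)⟩
      have h' := mul_mem (EP2_le_E (stab_rd_inv_mul_mem_EP2 ⟨σ * ε, hP⟩)) (inv_mem hε)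
      simpa [mul_assoc] using h'
    · rintro ⟨y, hy⟩
      induction y using K1Quot.ind with
      | h τ =>
      have h := (congrArg (firstRowClass m R) ((stabClass_mk τ).symm.trans hy)).symm
      exact h.trans (congrArg Pi0Um.mk (stab_mem_P τ))
  -- `ker β_v ≅ ker β_e` if and only if `v = e σ` for some `σ`.
  · intro x
    induction x using Pi0Um.ind with
    | h v =>
    rw [← kerClass_e]
    refine K0s.mk_eq_iff.trans (nonempty_ker_equiv_iff.trans ⟨?_, ?_⟩)
    · rintro ⟨σ, h⟩
      refine ⟨K1.mk σ⁻¹, congrArg Pi0Um.mk ?_⟩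
      rw [← h, ← Um.act_mul, mul_inv_cancel, Um.act_one]
    · rintro ⟨x, hx⟩
      induction x using K1.ind with
      | h σ =>
      obtain ⟨ε, -, h⟩ := Pi0Um.mk_eq_iff.1 hx
      refine ⟨(σ * ε)⁻¹, ?_⟩
      rw [← h, ← Um.act_mul (e m R) σ ε, ← Um.act_mul, mul_inv_cancel, Um.act_one]
  -- `M ⊕ R ≅ R^n` if and only if `M` is the kernel of a unimodular row.
  · intro x
    induction x using Quotient.ind with
    | _ M =>
    refine K0s.mk_eq_iff.trans ⟨?_, ?_⟩
    · rintro ⟨g⟩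
      obtain ⟨v, hv⟩ := exists_ker_equiv g
      exact ⟨Pi0Um.mk v, Quotient.sound hv⟩
    · rintro ⟨y, hy⟩
      induction y using Pi0Um.ind with
      | h v =>
      obtain ⟨g⟩ := Quotient.exact hy
      obtain ⟨f, -⟩ := exists_splitting v
      exact ⟨(g.symm.prodCongr (LinearEquiv.refl Rᵐᵒᵖ R)).trans f⟩
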